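/- **Setting.** Consider $\min_{x\in\mathbb R^n}F(x):=f(x)+\phi(x)-\psi(x)+\delta_{\mathbb R^m_-}(g(x))$, where: $g:\mathbb R^n\to\mathbb R^m$ is differentiable with locally Lipschitz Jacobian and $\Gamma:=g^{-1}(\mathbb R^m_-)\neq\emptyset$; $f:\mathbb R^n\to(-\infty,\infty]$ is proper, lower semicontinuous, and finite and differentiable with locally Lipschitz gradient on an open convex set $\mathcal O\supset\Gamma$; $\phi,\psi:\mathbb R^n\to\mathbb R$ are convex; $F$ is bounded from below on $\Gamma$. Here $\partial$ denotes the limiting (Mordukhovich) subdifferential, $\mathcal N_C=\partial\delta_C$ the limiting normal cone, $\nabla H(x)=H'(x)^{\top}$, and $\mathrm{dist}(\cdot,\emptyset)=\infty$. A point $x\in\Gamma$ is *strong stationary* if $0\in\nabla f(x)+\partial\phi(x)+\partial(-\psi)(x)+\nabla g(x)\,\mathcal N_{\mathbb R^m_-}(g(x))$. Put $G(x,s,L):=g(s)+g'(s)(x-s)+\tfrac12\|x-s\|^2L$. **Algorithm (inexact MBA).** Given $0<\mu_{\min}\le\mu_{\max}$, $0<L_{\min}\le L_{\max}$, $M,\beta_R,\beta_F,\alpha>0$,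 $\tau>1$ and $x^0\in\Gamma$, for $k=0,1,2,\dots$ choose $\xi^k\in\partial(-\psi)(x^k)$, $\mu_{k,0}\in[\mu_{\min},\mu_{\max}]$, $L^{k,0}\in[L_{\min},L_{\max}]^m$, and for $j=0,1,2,\dots$ do the following. Choose a symmetric linear map $\mathcal Q_{k,j}$ with $\mu_{k,j}I\preceq\mathcal Q_{k,j}\preceq(\mu_{k,j}+M)I$, and let $$\vartheta_{k,j}(x)=\langle\nabla f(x^k)+\xi^k,x-x^k\rangle+\tfrac12\langle x-x^k,\mathcal Q_{k,j}(x-x^k)\rangle+f(x^k)-\psi(x^k),\qquad F_{k,j}=\vartheta_{k,j}+\phi,$$ $\Gamma_{k,j}=\{x: G(x,x^k,L^{k,j})\le 0\}$, and let $\overline x^{k,j}$ be the minimizer of $F_{k,j}$ over $\Gamma_{k,j}$. Find $y^{k,j}$, $v^{k,j}\in\partial\phi(y^{k,j})$ and $\lambda^{k,j}\in\mathbb R^m_+$ with $$R_{k,j}(y^{k,j},v^{k,j},\lambda^{k,j})\le\tfrac{\beta_R}2\|y^{k,j}-x^k\|^2,\quad F_{k,j}(y^{k,j})\le F_{k,j}(x^k),\quad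 F_{k,j}(y^{k,j})-F_{k,j}(\overline x^{k,j})\le\tfrac{\beta_F}2\|y^{k,j}-x^k\|^2,$$ where, with $r=\nabla\vartheta_{k,j}(x)+v+\nabla_xG(x,x^k,L^{k,j})\lambda$, $$R_{k,j}(x,v,\lambda)=\langle x,r\rangle_++\big(-\langle\lambda,G(x,x^k,L^{k,j})\rangle\big)_++\|r\|+\big\|[G(x,x^k,L^{k,j})]_+\big\|_\infty .$$ If $g(y^{k,j})\le0$ and $F(y^{k,j})\le F(x^k)-\tfrac\alpha2\|y^{k,j}-x^k\|^2$, set $j_k=j$, $x^{k+1}=y^{k,j}$ and end the inner loop. Otherwise, if $g(y^{k,j})\not\le0$, set $(L^{k,j+1},\mu_{k,j+1})=(\tau L^{k,j},\mu_{k,j})$; else set $(L^{k,j+1},\mu_{k,j+1})=(L^{k,j},\tau\mu_{k,j})$. Write $L^k=L^{k,j_k}$, $\mathcal Q_k=\mathcal Q_{k,j_k}$, $\overline x^k=\overline x^{k,j_k}$. **Potential function.** For a constant $c>0$ let, for $w=(x,s,L,\xi,d)\in\mathbb R^n\times\mathbb R^n\times\mathbb R^m_{++}\times\mathbb R^n\times\mathbb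 R^n$, $$\Phi_c(w)=f(x)+\phi(x)+\delta_{\mathbb R^m_-}(G(x,s,L))+\langle x,\xi\rangle+\psi^*(-\xi)+c\|d\|^2,$$ where $\psi^*$ is the convex conjugate of $\psi$. Put $w^k=(\overline x^k,x^k,L^k,\xi^k,x^{k+1}-x^k)$, and let $W^*$ be the set of cluster points of $\{w^k\}$. A function $h:\mathbb R^N\to(-\infty,\infty]$ has the KL property at $\overline w\in\mathrm{dom}\,\partial h$ if there are $\delta>0$, $\eta\in(0,\infty]$ and a continuous concave $\varphi:[0,\eta)\to\mathbb R_+$, continuously differentiable on $(0,\eta)$, with $\varphi(0)=0$ and $\varphi'>0$ on $(0,\eta)$, such that $\varphi'(h(w)-h(\overline w))\,\mathrm{dist}(0,\partial h(w))\ge1$ whenever $\|w-\overline w\|\le\delta$ and $h(\overline w)<h(w)<h(\overline w)+\eta$. **Theorem.** Let $\{x^k\}_{k\in\mathbb N}$ be generated by the algorithm. Suppose that: 1. for all $k\in\mathbb N$ and $j\le j_k$, the multifunction $\mathcal G_{k,j}(z)=G(z,x^k,L^{k,j})-\mathbb R^m_-$ is metrically subregular at $(\overline x^{k,j},0)$,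 i.e. there are $\delta,\kappa>0$ with $\mathrm{dist}(z,\mathcal G_{k,j}^{-1}(0))\le\kappa\,\mathrm{dist}(0,\mathcal G_{k,j}(z))$ whenever $\|z-\overline x^{k,j}\|\le\delta$; 2. $\{x^k\}$ is bounded; let $\omega(x^0)$ be its set of cluster points; 3. (partial bounded multiplier property) with $u=(L,\mathcal Q,\xi,s)$ ranging over $\mathbb U=\mathbb R^m_+\times\{\text{symmetric positive definite }\mathcal Q\}\times\mathbb R^n\times\mathbb R^n$, $H(u,x)=G(x,s,L)$, $\mathcal S(u)=\{x:H(u,x)\le0\}$ and $u^k=(L^k,\mathcal Q_k,\xi^k,x^k)$, every cluster point $(u^*,\overline x^*)$ of $\{(u^k,\overline x^k)\}$ satisfies $u^*\in\mathbb U$ and $\overline x^*\in\mathcal S(u^*)$, and there are $\kappa>0$ and neighbourhoods $\mathcal U$ of $u^*$ and $\mathcal V$ of $\overline x^*$ such that for all $u\in\mathcal U\cap\mathbb U$, $x\in\mathcal V\cap\mathcal S(u)$ and $y\in\mathcal N_{\mathcal S(u)}(x)$ there is $\lambda\in\mathcal N_{\mathbb R^m_-}(H(u,x))$ with $\nabla_xH(u,x)\lambda=y$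 and $\|\lambda\|\le\kappa\|y\|$; 4. $g$ is twice differentiable; 5. for some constant $c>0$, $\Phi_c$ has the KL property at every point of $W^*$. Then $\sum_{k=0}^\infty\|x^{k+1}-x^k\|<\infty$; every point of $\omega(x^0)$ is strong stationary; and consequently $\{x^k\}$ converges to some $x^*\in\omega(x^0)$, which is a strong stationary point. -/

import Mathlib

open Filter Topology

namespace InexactMBA

/-- `ℝⁿ` with its Euclidean norm and inner product. -/
abbrev Vec (n : ℕ) : Type := EuclideanSpace ℝ (Fin n)

/-- The non-positive orthant of `ℝᵐ`. -/
def nonposOrthant (m : ℕ) : Set (Vec m) := {y | ∀ i, y i ≤ 0}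

open Classical in
/-- The indicator function of a set: `0` on the set and `+∞` off it. -/
noncomputable def indicatorFn {X : Type*} (C : Set X) (x : X) : EReal :=
  if x ∈ C then 0 else ⊤

/-- The set of cluster points of a sequence. -/
def clusterSet {X : Type*} [TopologicalSpace X] (s : ℕ → X) : Set X :=
  {a | MapClusterPt a atTop s}

/-! ### Variational analysis -/

section Variational

variable {E : Type*} [NormedAddCommGroup E] [InnerProductSpace ℝ E]

/-- Regular (Fréchet) subdifferential at a point where `h` is finite:
`h x' ≥ h x + ⟨v, x' - x⟩ + o(‖x' - x‖)`, which is the usual condition that the lower limit of the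
difference quotient is non-negative. It is empty where `h` is not finite. -/
def regSubdiff (h : E → EReal) (x : E) : Set E :=
  {v | h x ≠ ⊤ ∧ h x ≠ ⊥ ∧ ∀ ε : ℝ, 0 < ε → ∀ᶠ x' in 𝓝 x,
    h x + ((inner ℝ v (x' - x) - ε * ‖x' - x‖ : ℝ) : EReal) ≤ h x'}

/-- Basic (limiting, Mordukhovich) subdifferential; empty where `h` is not finite. -/
def limSubdiff (h : E → EReal) (x : E) : Set E :=
  {v | h x ≠ ⊤ ∧ h x ≠ ⊥ ∧ ∃ (xs vs : ℕ → E),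
    Tendsto xs atTop (𝓝 x) ∧ Tendsto (fun l => h (xs l)) atTop (𝓝 (h x)) ∧
    (∀ l, vs l ∈ regSubdiff h (xs l)) ∧ Tendsto vs atTop (𝓝 v)}

/-- Limiting normal cone, the limiting subdifferential of the indicator function
(empty at points outside the set). -/
def normalCone (C : Set E) (x : E) : Set E := limSubdiff (indicatorFn C) x

/-- The Fenchel conjugate of a finite function. -/
noncomputable def conjugate (ψ : E → ℝ) (y : E) : EReal :=
  ⨆ x : E, ((inner ℝ y x - ψ x : ℝ) : EReal)

/-- The interval `[0, η)` for `η ∈ (0, ∞]`. -/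
def desingDomain (η : EReal) : Set ℝ := {t | 0 ≤ t ∧ (t : EReal) < η}

/-- Desingularizing functions on `[0, η)`: continuous, concave, nonnegative, vanishing at `0`,
and continuously differentiable with positive derivative on `(0, η)`. -/
structure IsDesingularizing (η : EReal) (θ : ℝ → ℝ) : Prop where
  continuousOn : ContinuousOn θ (desingDomain η)
  concaveOn : ConcaveOn ℝ (desingDomain η) θ
  nonneg : ∀ t ∈ desingDomain η, 0 ≤ θ t
  zero : θ 0 = 0
  differentiableAt : ∀ t ∈ desingDomain η, 0 < t → DifferentiableAt ℝ θ t
  continuousOn_deriv : ContinuousOn (deriv θ) (desingDomain η ∩ Set.Ioi 0)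
  deriv_pos : ∀ t ∈ desingDomain η, 0 < t → 0 < deriv θ t

/-- The Kurdyka-Łojasiewicz property of `h` at a point of the domain of its limiting
subdifferential. The distance to the empty set is `∞`. -/
def HasKLAt (h : E → EReal) (a : E) : Prop :=
  (limSubdiff h a).Nonempty ∧
  ∃ δ : ℝ, 0 < δ ∧ ∃ η : EReal, 0 < η ∧ ∃ θ : ℝ → ℝ, IsDesingularizing η θ ∧
    ∀ x ∈ Metric.closedBall a δ, h a < h x → h x < h a + η →
      1 ≤ ENNReal.ofReal (deriv θ ((h x).toReal - (h a).toReal)) *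
        Metric.infEDist 0 (limSubdiff h x)

end Variational

/-- Metric subregularity of a multifunction `Φ` at a point `(a, b)` of its graph. -/
def MetricallySubregular {X Y : Type*} [PseudoMetricSpace X] [PseudoMetricSpace Y]
    (Φ : X → Set Y) (a : X) (b : Y) : Prop :=
  b ∈ Φ a ∧ ∃ δ : ℝ, 0 < δ ∧ ∃ κ : ℝ, 0 < κ ∧ ∀ x ∈ Metric.closedBall a δ,
    Metric.infEDist x {x' | b ∈ Φ x'} ≤ ENNReal.ofReal κ * Metric.infEDist b (Φ x)

/-- The multifunction `z ↦ H z - ℝ₋ᵐ`. -/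
def constraintMap {n m : ℕ} (H : Vec n → Vec m) (z : Vec n) : Set (Vec m) :=
  {y | ∃ r ∈ nonposOrthant m, y = H z - r}

/-- The transposed Jacobian `∇H(x) = H'(x)ᵀ`. -/
noncomputable def jacT {n m : ℕ} (H : Vec n → Vec m) (x : Vec n) : Vec m →L[ℝ] Vec n :=
  ContinuousLinearMap.adjoint (fderiv ℝ H x)

/-! ### The partial bounded multiplier property -/

section BMP

variable {P : Type*} [TopologicalSpace P] {n m : ℕ}

/-- Solution set of the parametric system `H(u, x) ≤ 0`. -/
def solSet (H : P → Vec n → Vec m) (u : P) : Set (Vec n) :=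
  {x | H u x ∈ nonposOrthant m}

/-- Multipliers `μ ∈ N_{ℝ₋ᵐ}(H(u, x))` with `∇ₓH(u, x) μ = y`. -/
def multSet (H : P → Vec n → Vec m) (u : P) (x y : Vec n) : Set (Vec m) :=
  {μ | μ ∈ normalCone (nonposOrthant m) (H u x) ∧ jacT (H u) x μ = y}

/-- Partial bounded multiplier property with respect to `x` at `(a, b)`, the parameter ranging over
the set `U`. -/
def PartialBMP (U : Set P) (H : P → Vec n → Vec m) (a : P) (b : Vec n) : Prop :=
  a ∈ U ∧ b ∈ solSet H a ∧
  ∃ κ : ℝ, 0 < κ ∧ ∃ A ∈ 𝓝 a, ∃ B ∈ 𝓝 b, ∀ u ∈ A ∩ U, ∀ x ∈ B ∩ solSet H u,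
    ∀ y ∈ normalCone (solSet H u) x, ∃ μ ∈ multSet H u x y, ‖μ‖ ≤ κ * ‖y‖

end BMP

/-! ### The constrained DC problem -/

section Problem

variable {n m : ℕ}

/-- The feasible set `Γ = g⁻¹(ℝ₋ᵐ)`. -/
def feasibleSet (g : Vec n → Vec m) : Set (Vec n) := g ⁻¹' nonposOrthant m

/-- The objective `F = f + φ - ψ + δ_Γ`. -/
noncomputable def objective (f : Vec n → EReal) (φ ψ : Vec n → ℝ) (g : Vec n → Vec m)
    (x : Vec n) : EReal :=
  f x + ((φ x - ψ x : ℝ) : EReal) + indicatorFn (feasibleSet g) x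

/-- The gradient of the extended-real-valued `f` (used only where `f` is finite near the point). -/
noncomputable def grad (f : Vec n → EReal) (x : Vec n) : Vec n :=
  gradient (fun z => (f z).toReal) x

/-- The basic conditions on the data of the problem. -/
structure BasicAssumption (f : Vec n → EReal) (φ ψ : Vec n → ℝ) (g : Vec n → Vec m) : Prop where
  /-- `g` is differentiable with locally Lipschitz derivative -/
  g_diff : Differentiable ℝ g
  g_lip : LocallyLipschitz (fderiv ℝ g)
  feasible : (feasibleSet g).Nonempty
  /-- `f` is proper and lower semicontinuous -/
  f_ne_bot : ∀ x, f x ≠ ⊥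
  f_proper : ∃ x, f x ≠ ⊤
  f_lsc : LowerSemicontinuous f
  /-- `f` is finite and differentiable with locally Lipschitz gradient on an open convex set
  containing the feasible set -/
  f_smooth : ∃ O : Set (Vec n), IsOpen O ∧ Convex ℝ O ∧ feasibleSet g ⊆ O ∧
    (∀ x ∈ O, f x ≠ ⊤) ∧ DifferentiableOn ℝ (fun z => (f z).toReal) O ∧
    LocallyLipschitzOn O (grad f)
  phi_convex : ConvexOn ℝ Set.univ φ
  psi_convex : ConvexOn ℝ Set.univ ψ
  bddBelow : ∃ b : ℝ, ∀ x ∈ feasibleSet g, (b : EReal) ≤ objective f φ ψ g x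

/-- `∂φ` for the finite function `φ`. -/
def subdiff (φ : Vec n → ℝ) (x : Vec n) : Set (Vec n) :=
  limSubdiff (fun z => (φ z : EReal)) x

/-- The strong stationary points: feasible `x` with
`0 ∈ ∇f(x) + ∂φ(x) + ∂(-ψ)(x) + ∇g(x) N_{ℝ₋ᵐ}(g(x))`. -/
def strongStationary (f : Vec n → EReal) (φ ψ : Vec n → ℝ) (g : Vec n → Vec m) : Set (Vec n) :=
  {x | x ∈ feasibleSet g ∧ ∃ v ∈ subdiff φ x, ∃ ξ ∈ subdiff (fun z => -ψ z) x,
    ∃ μ ∈ normalCone (nonposOrthant m) (g x), 0 = grad f x + v + ξ + jacT g x μ}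

/-- The moving balls model `G(x, s, L) = g(s) + g'(s)(x - s) + ½‖x - s‖² L`. -/
noncomputable def ballMap (g : Vec n → Vec m) (x s : Vec n) (L : Vec m) : Vec m :=
  g s + fderiv ℝ g s (x - s) + ((1 / 2 : ℝ) * ‖x - s‖ ^ 2) • L

/-- The quadratic model `ϑ` of `f - ψ` at `s`, with metric `Q` and `ξ ∈ ∂(-ψ)(s)`. -/
noncomputable def quadModel (f : Vec n → EReal) (ψ : Vec n → ℝ) (s ξ : Vec n)
    (Q : Vec n →L[ℝ] Vec n) (x : Vec n) : ℝ :=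
  inner ℝ (grad f s + ξ) (x - s) + (1 / 2 : ℝ) * inner ℝ (x - s) (Q (x - s))
    + (f s).toReal - ψ s

/-- The subproblem's objective `ϑ + φ`. -/
noncomputable def subObj (f : Vec n → EReal) (φ ψ : Vec n → ℝ) (s ξ : Vec n)
    (Q : Vec n →L[ℝ] Vec n) (x : Vec n) : ℝ :=
  quadModel f ψ s ξ Q x + φ x

/-- The subproblem's feasible set `{x | G(x, s, L) ≤ 0}`. -/
def subFeasible (g : Vec n → Vec m) (s : Vec n) (L : Vec m) : Set (Vec n) :=
  {x | ballMap g x s L ∈ nonposOrthant m}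

/-- The dual residual `∇ϑ(x) + v + ∇ₓG(x, s, L) μ`. -/
noncomputable def dualResidual (f : Vec n → EReal) (ψ : Vec n → ℝ) (g : Vec n → Vec m)
    (s ξ : Vec n) (Q : Vec n →L[ℝ] Vec n) (L : Vec m) (x v : Vec n) (μ : Vec m) : Vec n :=
  gradient (quadModel f ψ s ξ Q) x + v + jacT (fun z => ballMap g z s L) x μ

/-- The KKT residual of the subproblem. Its last term is the `ℓ_∞` norm of the positive part of
`G(x, s, L)` (the norm of `Fin m → ℝ` is the sup norm). -/
noncomputable def kktResidual (f : Vec n → EReal) (ψ : Vec n → ℝ) (g : Vec n → Vec m)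
    (s ξ : Vec n) (Q : Vec n →L[ℝ] Vec n) (L : Vec m) (x v : Vec n) (μ : Vec m) : ℝ :=
  max (inner ℝ x (dualResidual f ψ g s ξ Q L x v μ)) 0
    + max (-inner ℝ μ (ballMap g x s L)) 0
    + ‖dualResidual f ψ g s ξ Q L x v μ‖
    + ‖(fun i => max (ballMap g x s L i) 0 : Fin m → ℝ)‖

/-! ### The inexact moving balls approximation method -/

/-- Input parameters of the method. -/
structure Params where
  muMin : ℝ
  muMax : ℝ
  LMin : ℝ
  LMax : ℝ
  M : ℝ
  betaR : ℝ
  betaF : ℝ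
  alpha : ℝ
  tau : ℝ
  muMin_pos : 0 < muMin
  muMin_le : muMin ≤ muMax
  LMin_pos : 0 < LMin
  LMin_le : LMin ≤ LMax
  M_pos : 0 < M
  betaR_pos : 0 < betaR
  betaF_pos : 0 < betaF
  alpha_pos : 0 < alpha
  one_lt_tau : 1 < tau

/-- The quantities that occur in a run of the method. Doubly indexed ones are indexed by the outer
counter `k` and the inner counter `j`; only the indices `j ≤ jlast k` matter. `mult k j` is the
multiplier `λ^{k,j}` and `xbar k j` is the exact solution of the subproblem. -/
structure Run (n m : ℕ) where
  x : ℕ → Vec n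
  xi : ℕ → Vec n
  jlast : ℕ → ℕ
  mu : ℕ → ℕ → ℝ
  L : ℕ → ℕ → Vec m
  Q : ℕ → ℕ → (Vec n →L[ℝ] Vec n)
  y : ℕ → ℕ → Vec n
  v : ℕ → ℕ → Vec n
  mult : ℕ → ℕ → Vec m
  xbar : ℕ → ℕ → Vec n

/-- The acceptance test of the inner loop: `g(y) ≤ 0` and `F(y) ≤ F(s) - (α/2)‖y - s‖²`. -/
def Accepts (f : Vec n → EReal) (φ ψ : Vec n → ℝ) (g : Vec n → Vec m) (alpha : ℝ)
    (s y : Vec n) : Prop :=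
  y ∈ feasibleSet g ∧
    objective f φ ψ g y ≤ objective f φ ψ g s - ((alpha / 2 * ‖y - s‖ ^ 2 : ℝ) : EReal)

/-- `r` is a run of the inexact moving balls approximation method. -/
structure IsRun (f : Vec n → EReal) (φ ψ : Vec n → ℝ) (g : Vec n → Vec m)
    (p : Params) (r : Run n m) : Prop where
  init : r.x 0 ∈ feasibleSet g
  xi_mem : ∀ k, r.xi k ∈ subdiff (fun z => -ψ z) (r.x k)
  mu_init : ∀ k, p.muMin ≤ r.mu k 0 ∧ r.mu k 0 ≤ p.muMax
  L_init : ∀ k i, p.LMin ≤ r.L k 0 i ∧ r.L k 0 i ≤ p.LMax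
  /-- `μ I ⪯ Q ⪯ (μ + M) I` -/
  Q_lower : ∀ k, ∀ j ≤ r.jlast k,
    (r.Q k j - r.mu k j • ContinuousLinearMap.id ℝ (Vec n)).IsPositive
  Q_upper : ∀ k, ∀ j ≤ r.jlast k,
    ((r.mu k j + p.M) • ContinuousLinearMap.id ℝ (Vec n) - r.Q k j).IsPositive
  /-- `xbar k j` is the exact solution of the subproblem -/
  xbar_mem : ∀ k, ∀ j ≤ r.jlast k, r.xbar k j ∈ subFeasible g (r.x k) (r.L k j)
  xbar_min : ∀ k, ∀ j ≤ r.jlast k,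
    IsMinOn (subObj f φ ψ (r.x k) (r.xi k) (r.Q k j)) (subFeasible g (r.x k) (r.L k j)) (r.xbar k j)
  /-- the inexactness criterion satisfied by `y k j` -/
  v_mem : ∀ k, ∀ j ≤ r.jlast k, r.v k j ∈ subdiff φ (r.y k j)
  mult_nonneg : ∀ k, ∀ j ≤ r.jlast k, ∀ i, 0 ≤ r.mult k j i
  residual_le : ∀ k, ∀ j ≤ r.jlast k,
    kktResidual f ψ g (r.x k) (r.xi k) (r.Q k j) (r.L k j) (r.y k j) (r.v k j) (r.mult k j)
      ≤ p.betaR / 2 * ‖r.y k j - r.x k‖ ^ 2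
  descent : ∀ k, ∀ j ≤ r.jlast k,
    subObj f φ ψ (r.x k) (r.xi k) (r.Q k j) (r.y k j)
      ≤ subObj f φ ψ (r.x k) (r.xi k) (r.Q k j) (r.x k)
  gap_le : ∀ k, ∀ j ≤ r.jlast k,
    subObj f φ ψ (r.x k) (r.xi k) (r.Q k j) (r.y k j)
      - subObj f φ ψ (r.x k) (r.xi k) (r.Q k j) (r.xbar k j)
      ≤ p.betaF / 2 * ‖r.y k j - r.x k‖ ^ 2
  /-- the inner loop continues while the test fails, and updates `L` or `μ` -/
  continues : ∀ k, ∀ j < r.jlast k, ¬ Accepts f φ ψ g p.alpha (r.x k) (r.y k j)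
  update_L : ∀ k, ∀ j < r.jlast k, r.y k j ∉ feasibleSet g →
    r.L k (j + 1) = p.tau • r.L k j ∧ r.mu k (j + 1) = r.mu k j
  update_mu : ∀ k, ∀ j < r.jlast k, r.y k j ∈ feasibleSet g →
    r.L k (j + 1) = r.L k j ∧ r.mu k (j + 1) = p.tau * r.mu k j
  /-- the inner loop ends at `jlast k`, which gives the next iterate -/
  accepted : ∀ k, Accepts f φ ψ g p.alpha (r.x k) (r.y k (r.jlast k))
  next : ∀ k, r.x (k + 1) = r.y k (r.jlast k)

/-- Metric subregularity of `G(·, xᵏ, L^{k,j}) - ℝ₋ᵐ` at `(xbar^{k,j}, 0)` for all subproblems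
of the run. -/
def SubproblemsSubregular (g : Vec n → Vec m) (r : Run n m) : Prop :=
  ∀ k, ∀ j ≤ r.jlast k, MetricallySubregular
    (constraintMap (fun z => ballMap g z (r.x k) (r.L k j))) (r.xbar k j) 0

/-- The space of the parameters `u = (L, Q, ξ, s)`. -/
abbrev ParamSpace (n m : ℕ) : Type := Vec m × (Vec n →L[ℝ] Vec n) × Vec n × Vec n

/-- The admissible parameters: `L ≥ 0` and `Q` symmetric positive definite. -/
def paramSet (n m : ℕ) : Set (ParamSpace n m) :=
  {u | (∀ i, 0 ≤ u.1 i) ∧ u.2.1.IsPositive ∧ ∀ z : Vec n, z ≠ 0 → 0 < inner ℝ z (u.2.1 z)}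

/-- `H(u, x) = G(x, s, L)` for `u = (L, Q, ξ, s)`. -/
noncomputable def paramConstraint (g : Vec n → Vec m) (u : ParamSpace n m) (x : Vec n) : Vec m :=
  ballMap g x u.2.2.2 u.1

/-- `(uᵏ, xbarᵏ)` with `uᵏ = (Lᵏ, Qₖ, ξᵏ, xᵏ)`. -/
def paramSeq (r : Run n m) (k : ℕ) : ParamSpace n m × Vec n :=
  ((r.L k (r.jlast k), r.Q k (r.jlast k), r.xi k, r.x k), r.xbar k (r.jlast k))

/-! ### The potential function -/

/-- The Euclidean space of `w = (z, d)` with `z = (x, s, L, ξ)`. -/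
abbrev PotSpace (n m : ℕ) : Type :=
  WithLp 2 (WithLp 2 (Vec n × WithLp 2 (Vec n × WithLp 2 (Vec m × Vec n))) × Vec n)

/-- The point `((x, s, L, ξ), d)`. -/
noncomputable def potPoint (x s : Vec n) (L : Vec m) (ξ d : Vec n) : PotSpace n m :=
  WithLp.toLp 2 (WithLp.toLp 2 (x, WithLp.toLp 2 (s, WithLp.toLp 2 (L, ξ))), d)

/-- `Φ(x, s, L, ξ) = f(x) + φ(x) + δ_{G⁻¹(ℝ₋ᵐ)}(x, s, L) + ⟨x, ξ⟩ + ψ*(-ξ)`, whose domain of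
definition is `L > 0`; it is extended by `+∞` elsewhere. -/
noncomputable def potentialBase (f : Vec n → EReal) (φ ψ : Vec n → ℝ) (g : Vec n → Vec m)
    (x s : Vec n) (L : Vec m) (ξ : Vec n) : EReal :=
  f x + (φ x : EReal)
    + indicatorFn {q : Vec n × Vec n × Vec m | (∀ i, 0 < q.2.2 i) ∧
        ballMap g q.1 q.2.1 q.2.2 ∈ nonposOrthant m} (x, s, L)
    + ((inner ℝ x ξ : ℝ) : EReal) + conjugate ψ (-ξ)

/-- `Φ_c(z, d) = Φ(z) + c‖d‖²`. -/
noncomputable def potential (f : Vec n → EReal) (φ ψ : Vec n → ℝ) (g : Vec n → Vec m) (c : ℝ)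
    (w : PotSpace n m) : EReal :=
  potentialBase f φ ψ g w.fst.fst w.fst.snd.fst w.fst.snd.snd.fst w.fst.snd.snd.snd
    + ((c * ‖w.snd‖ ^ 2 : ℝ) : EReal)

/-- `wᵏ = (xbarᵏ, xᵏ, Lᵏ, ξᵏ, xᵏ⁺¹ - xᵏ)`. -/
noncomputable def potSeq (r : Run n m) (k : ℕ) : PotSpace n m :=
  potPoint (r.xbar k (r.jlast k)) (r.x k) (r.L k (r.jlast k)) (r.xi k) (r.x (k + 1) - r.x k)

end Problem

end InexactMBA

open InexactMBA

/-! Write `d_k = ‖x^{k+1} - x^k‖`. The acceptance test gives `F(x^k) - F(x^{k+1}) ≥ (α/2) d_k²`, so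
`F(x^k)` decreases to a limit `F*` and `d_k → 0`. The rest transfers the KL inequality for the
potential to these steps.

Uniform constants. Bounded iterates make the trial points and exact solutions bounded. A failed test
forces some component of `L` or `μ` below a fixed threshold, so `L` and `Q` are bounded as well
(`IsRun.exists_L_le`, `IsRun.exists_mu_le`). The parameter sequence then lies in a compact set,
finitely many neighbourhoods from the multiplier property cover its tail, and the multipliers at the
exact solutions `xbar^k` are bounded. Inserting `x^{k+1}` into the strongly convex Lagrangian of the
subproblem, where both the optimality gap and the constraint violation are `O(d_k²)`, yields
`‖xbar^k - x^k‖ ≤ C d_k` (`IsRun.exists_isBoundedKKT`). Strong stationarity of cluster points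
follows by passing to the limit in these optimality conditions.

Subgradients of the potential. No calculus rule for limiting subdifferentials is used. At the points
of interest the potential has a differentiable minorant that touches it: `φ` is replaced by an
affine support, the indicator by the Lagrangian term `⟨l, G⟩`, and `ψ*` by one of the affine
functions in its supremum. The gradient of the minorant is a regular subgradient; by the optimality
conditions it is `O(d_k)` (`exists_mem_regSubdiff_potential`, `IsRun.exists_subgradient_bound`).

Values of the potential. The constant `c` is prescribed, so the last coordinate of `w^k` is rescaled
to `ρ (x^{k+1} - x^k)`. For suitable `ρ` the value at the rescaled point is at least `F(x^{k+1})`.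
The rescaling tends to zero in norm, so the points keep the same cluster points, on which the
potential equals `F*`.

Conclusion. With `r_k = F(x^k) - F*`, KL and the monotonicity of `θ'` give `1 ≤ θ'(r_{k+1}) b d_k`.
Concavity of `θ` bounds `θ'(r_{k+1}) (r_{k+1} - r_{k+2})` by a decrease of `θ`, and the
arithmetic-geometric mean inequality gives `d_{k+1} ≤ d_k / 2` plus a telescoping term
(`summable_of_desingularizing`). Summable steps make the sequence Cauchy. -/

namespace InexactMBA

/-! ### Convex subgradients, normal cones and limiting subdifferentials -/

section Subgradients

variable {E : Type*} [NormedAddCommGroup E] [InnerProductSpace ℝ E]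

/-- Subgradients in the sense of convex analysis. -/
def IsSubgrad (φ : E → ℝ) (x v : E) : Prop :=
  ∀ z, φ x + inner ℝ v (z - x) ≤ φ z

theorem IsSubgrad.mem_regSubdiff {φ : E → ℝ} {x v : E} (h : IsSubgrad φ x v) :
    v ∈ regSubdiff (fun z => (φ z : EReal)) x := by
  refine ⟨EReal.coe_ne_top _, EReal.coe_ne_bot _, fun ε hε => Eventually.of_forall fun z => ?_⟩
  rw [← EReal.coe_add, EReal.coe_le_coe_iff]
  have := h z
  have : 0 ≤ ε * ‖z - x‖ := by positivity
  linarith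

theorem regSubdiff_subset_limSubdiff {h : E → EReal} {x v : E} (hv : v ∈ regSubdiff h x) :
    v ∈ limSubdiff h x :=
  ⟨hv.1, hv.2.1, fun _ => x, fun _ => v, tendsto_const_nhds, tendsto_const_nhds, fun _ => hv,
    tendsto_const_nhds⟩

/-- A regular subgradient of a concave function is minus a subgradient of its convex negative. -/
theorem isSubgrad_neg_of_mem_regSubdiff_neg {ψ : E → ℝ} (hψ : ConvexOn ℝ Set.univ ψ) {x v : E}
    (hv : v ∈ regSubdiff (fun z => ((-ψ z : ℝ) : EReal)) x) : IsSubgrad ψ x (-v) := by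
  intro z
  obtain ⟨-, -, hv⟩ := hv
  refine le_of_forall_pos_le_add fun δ hδ => ?_
  set ε : ℝ := δ / (‖z - x‖ + 1) with hε
  have hεpos : 0 < ε := by positivity
  have hεδ : ε * ‖z - x‖ ≤ δ := by
    rw [hε, div_mul_eq_mul_div, div_le_iff₀ (by positivity)]
    nlinarith [norm_nonneg (z - x)]
  have hlim : Tendsto (fun t : ℝ => x - t • (z - x)) (𝓝[>] 0) (𝓝 x) := by
    have : Tendsto (fun t : ℝ => x - t • (z - x)) (𝓝 0) (𝓝 (x - (0 : ℝ) • (z - x))) :=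
      Continuous.tendsto (by fun_prop) 0
    rw [zero_smul, sub_zero] at this
    exact this.mono_left nhdsWithin_le_nhds
  obtain ⟨t, ht, ht0⟩ := ((hlim.eventually (hv ε hεpos)).and self_mem_nhdsWithin).exists
  have ht0 : 0 < t := ht0
  simp only [← EReal.coe_add, EReal.coe_le_coe_iff] at ht
  rw [show x - t • (z - x) - x = -(t • (z - x)) by abel, inner_neg_right, inner_smul_right,
    norm_neg, norm_smul, Real.norm_of_nonneg ht0.le] at ht
  -- The subgradient inequality for `-ψ` bounds `ψ` from above at the point `x - t (z - x)` behind
  -- `x`. Since `x` lies between that point and `z`, convexity turns this into a lower bound for `ψ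
  -- z`.
  have hc := hψ.2 (Set.mem_univ (x - t • (z - x))) (Set.mem_univ z)
    (show (0 : ℝ) ≤ 1 / (1 + t) by positivity) (show (0 : ℝ) ≤ t / (1 + t) by positivity)
    (by field_simp)
  have hx : (1 / (1 + t)) • (x - t • (z - x)) + (t / (1 + t)) • z = x := by
    have h1 : (1 + t) ≠ 0 := by positivity
    have : (1 + t) • ((1 / (1 + t)) • (x - t • (z - x)) + (t / (1 + t)) • z) = (1 + t) • x := by
      rw [smul_add, smul_smul, smul_smul, mul_one_div_cancel h1, mul_div_cancel₀ _ h1]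
      module
    exact smul_right_injective E h1 this
  rw [hx, smul_eq_mul, smul_eq_mul] at hc
  have hc' : (1 + t) * ψ x ≤ ψ (x - t • (z - x)) + t * ψ z := by
    have h1 : 0 < 1 + t := by positivity
    calc (1 + t) * ψ x ≤ (1 + t) * (1 / (1 + t) * ψ (x - t • (z - x)) + t / (1 + t) * ψ z) := by
          gcongr
      _ = _ := by field_simp
  rw [inner_neg_left]
  have : t * ψ x ≤ t * (ψ z + inner ℝ v (z - x) + ε * ‖z - x‖) := by nlinarith
  have := le_of_mul_le_mul_left this ht0
  linarith

theorem IsSubgrad.of_tendsto {φ : E → ℝ} (hφ : Continuous φ) {ι : Type*} {l : Filter ι} [l.NeBot]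
    {xs vs : ι → E} {x v : E} (hx : Tendsto xs l (𝓝 x)) (hv : Tendsto vs l (𝓝 v))
    (h : ∀ᶠ i in l, IsSubgrad φ (xs i) (vs i)) : IsSubgrad φ x v := by
  intro z
  refine le_of_tendsto (((hφ.tendsto x).comp hx).add (hv.inner (tendsto_const_nhds.sub hx))) ?_
  filter_upwards [h] with i hi using hi z

/-- Convex subgradient inequalities are closed under limits, so the regular case suffices. Only this
inclusion is needed: it gives an affine majorant of `-ψ` at the iterates and the exact value of `ψ*`
at `-ξ`. The converse fails already for `ψ = |·|` at `0`. -/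
theorem isSubgrad_neg_of_mem_limSubdiff_neg {ψ : E → ℝ} (hψ : ConvexOn ℝ Set.univ ψ)
    (hc : Continuous ψ) {x v : E} (hv : v ∈ limSubdiff (fun z => ((-ψ z : ℝ) : EReal)) x) :
    IsSubgrad ψ x (-v) := by
  obtain ⟨-, -, xs, vs, hx, -, hm, hv⟩ := hv
  exact IsSubgrad.of_tendsto hc hx hv.neg
    (Eventually.of_forall fun l => isSubgrad_neg_of_mem_regSubdiff_neg hψ (hm l))

/-- The graph of the limiting subdifferential of a continuous function is closed. -/
theorem mem_limSubdiff_of_tendsto {h : E → ℝ} (hc : Continuous h) {xs vs : ℕ → E} {x v : E}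
    (hx : Tendsto xs atTop (𝓝 x)) (hv : Tendsto vs atTop (𝓝 v))
    (hm : ∀ k, vs k ∈ limSubdiff (fun z => (h z : EReal)) (xs k)) :
    v ∈ limSubdiff (fun z => (h z : EReal)) x := by
  -- Diagonal choice: one regular pair within `1 / (k + 1)` of the `k`-th limiting pair. Convergence
  -- of the function values is automatic by continuity.
  have key : ∀ k : ℕ, ∃ a b, b ∈ regSubdiff (fun z => (h z : EReal)) a ∧
      dist a (xs k) < 1 / ((k : ℝ) + 1) ∧ dist b (vs k) < 1 / ((k : ℝ) + 1) := by
    intro k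
    obtain ⟨-, -, as, bs, ha, -, hab, hb⟩ := hm k
    have hk : (0 : ℝ) < 1 / ((k : ℝ) + 1) := by positivity
    obtain ⟨l, h1, h2⟩ := ((Metric.tendsto_nhds.1 ha _ hk).and (Metric.tendsto_nhds.1 hb _ hk)).exists
    exact ⟨as l, bs l, hab l, h1, h2⟩
  choose a b hab ha hb using key
  have hlim : ∀ {c d : ℕ → E} {e : E}, Tendsto d atTop (𝓝 e) →
      (∀ k : ℕ, dist (c k) (d k) < 1 / ((k : ℝ) + 1)) → Tendsto c atTop (𝓝 e) := by
    intro c d e hd hcd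
    refine tendsto_of_tendsto_of_dist hd ?_
    refine squeeze_zero (fun _ => dist_nonneg) (fun k => ?_) tendsto_one_div_add_atTop_nhds_zero_nat
    rw [dist_comm]
    exact (hcd k).le
  have hax := hlim hx ha
  exact ⟨EReal.coe_ne_top _, EReal.coe_ne_bot _, a, b, hax,
    (continuous_coe_real_ereal.tendsto _).comp ((hc.tendsto x).comp hax), hab, hlim hv hb⟩

/-- A function with a differentiable minorant touching it at `x` has the gradient of the minorant
as a regular subgradient. -/
theorem mem_regSubdiff_of_minorant [CompleteSpace E] {h : E → EReal} {S : E → ℝ} {x : E}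
    {A : E →L[ℝ] ℝ} (hS : HasFDerivAt S A x) (hle : ∀ᶠ z in 𝓝 x, (S z : EReal) ≤ h z)
    (heq : h x = S x) : (InnerProductSpace.toDual ℝ E).symm A ∈ regSubdiff h x := by
  refine ⟨heq ▸ EReal.coe_ne_top _, heq ▸ EReal.coe_ne_bot _, fun ε hε => ?_⟩
  filter_upwards [hle, hS.isLittleO.def hε] with z hz h1
  refine le_trans ?_ hz
  rw [heq, ← EReal.coe_add, EReal.coe_le_coe_iff]
  rw [Real.norm_eq_abs] at h1
  rw [InnerProductSpace.toDual_symm_apply]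
  linarith [neg_abs_le (S z - S x - A (z - x))]

theorem indicatorFn_of_mem {X : Type*} {C : Set X} {x : X} (h : x ∈ C) : indicatorFn C x = 0 :=
  if_pos h

theorem indicatorFn_of_notMem {X : Type*} {C : Set X} {x : X} (h : x ∉ C) :
    indicatorFn C x = ⊤ :=
  if_neg h

theorem mem_of_indicatorFn_ne_top {X : Type*} {C : Set X} {x : X} (h : indicatorFn C x ≠ ⊤) :
    x ∈ C := by
  by_contra hx
  exact h (indicatorFn_of_notMem hx)

theorem mem_normalCone_of_forall {C : Set E} {x v : E} (hx : x ∈ C)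
    (h : ∀ z ∈ C, inner ℝ v (z - x) ≤ 0) : v ∈ normalCone C x := by
  refine regSubdiff_subset_limSubdiff ⟨?_, ?_, fun ε hε => Eventually.of_forall fun z => ?_⟩
  · simp [indicatorFn_of_mem hx]
  · simp [indicatorFn_of_mem hx]
  · by_cases hz : z ∈ C
    · rw [indicatorFn_of_mem hx, indicatorFn_of_mem hz, zero_add, ← EReal.coe_zero,
        EReal.coe_le_coe_iff]
      have := h z hz
      have : 0 ≤ ε * ‖z - x‖ := by positivity
      linarith
    · rw [indicatorFn_of_notMem hz]
      exact le_top

/-- The segment from `x` to `z` stays in `C`. Along it both the linear term and the error scale with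
`t`, so dividing by `t` leaves an arbitrarily small error. -/
theorem inner_le_zero_of_mem_regSubdiff_indicatorFn {C : Set E} (hC : Convex ℝ C) {x v : E}
    (hv : v ∈ regSubdiff (indicatorFn C) x) {z : E} (hz : z ∈ C) : inner ℝ v (z - x) ≤ 0 := by
  obtain ⟨hx, -, hv⟩ := hv
  have hx := mem_of_indicatorFn_ne_top hx
  refine le_of_forall_pos_le_add fun δ hδ => ?_
  set ε : ℝ := δ / (‖z - x‖ + 1) with hε
  have hεpos : 0 < ε := by positivity
  have hεδ : ε * ‖z - x‖ ≤ δ := by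
    rw [hε, div_mul_eq_mul_div, div_le_iff₀ (by positivity)]
    nlinarith [norm_nonneg (z - x)]
  have hlim : Tendsto (fun t : ℝ => x + t • (z - x)) (𝓝[>] 0) (𝓝 x) := by
    have : Tendsto (fun t : ℝ => x + t • (z - x)) (𝓝 0) (𝓝 (x + (0 : ℝ) • (z - x))) :=
      Continuous.tendsto (by fun_prop) 0
    rw [zero_smul, add_zero] at this
    exact this.mono_left nhdsWithin_le_nhds
  obtain ⟨t, ht, ht01⟩ := ((hlim.eventually (hv ε hεpos)).and
    (Ioc_mem_nhdsGT (zero_lt_one' ℝ))).exists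
  have hmem : x + t • (z - x) ∈ C := hC.add_smul_sub_mem hx hz ⟨ht01.1.le, ht01.2⟩
  rw [indicatorFn_of_mem hx, indicatorFn_of_mem hmem, zero_add, ← EReal.coe_zero,
    EReal.coe_le_coe_iff, add_sub_cancel_left, inner_smul_right, norm_smul,
    Real.norm_of_nonneg ht01.1.le] at ht
  have : t * inner ℝ v (z - x) ≤ t * (ε * ‖z - x‖) := by linarith
  have := le_of_mul_le_mul_left this ht01.1
  linarith

theorem mem_and_inner_le_zero_of_mem_normalCone {C : Set E} (hC : Convex ℝ C) {x v : E}
    (hv : v ∈ normalCone C x) : x ∈ C ∧ ∀ z ∈ C, inner ℝ v (z - x) ≤ 0 := by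
  obtain ⟨hx, -, xs, vs, hxs, -, hm, hvs⟩ := hv
  refine ⟨mem_of_indicatorFn_ne_top hx, fun z hz => ?_⟩
  exact le_of_tendsto (hvs.inner (tendsto_const_nhds.sub hxs)) (Eventually.of_forall fun l =>
    inner_le_zero_of_mem_regSubdiff_indicatorFn hC (hm l) hz)

/-- Optimality condition for minimizing `⟨a, ·⟩ + φ` over a convex set. -/
theorem exists_isSubgrad_of_forall_le [CompleteSpace E] {φ : E → ℝ} (hφ : ConvexOn ℝ Set.univ φ)
    (hc : Continuous φ) {C : Set E} (hC : Convex ℝ C) {x a : E} (hx : x ∈ C)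
    (hmin : ∀ z ∈ C, 0 ≤ inner ℝ a (z - x) + φ z - φ x) :
    ∃ v, IsSubgrad φ x v ∧ ∀ z ∈ C, 0 ≤ inner ℝ (a + v) (z - x) := by
  set q : E → ℝ := fun z => inner ℝ a (z - x) + φ z - φ x with hq
  have hqc : Continuous q := by fun_prop
  have hqconv : ConvexOn ℝ Set.univ q := by
    refine ⟨convex_univ, fun y _ z _ s t hs ht hst => ?_⟩
    have := hφ.2 (Set.mem_univ y) (Set.mem_univ z) hs ht hst
    simp only [hq, smul_eq_mul] at this ⊢
    have e : s • y + t • z - x = s • (y - x) + t • (z - x) := by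
      rw [smul_sub, smul_sub]
      nth_rewrite 1 [← one_smul ℝ x]
      rw [← hst]
      module
    rw [e, inner_add_right, inner_smul_right, inner_smul_right]
    have : φ x = s * φ x + t * φ x := by rw [← add_mul, hst, one_mul]
    linarith
  have hq0 : q x = 0 := by simp [hq]
  -- The strict epigraph of `q`, open because `φ` is continuous, is separated from `C × (-∞, 0]`;
  -- disjointness is the minimality of `x`.
  have hU : Convex ℝ {w : E × ℝ | q w.1 < w.2} := by
    simpa using hqconv.convex_strict_epigraph
  have hUo : IsOpen {w : E × ℝ | q w.1 < w.2} :=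
    isOpen_lt (hqc.comp continuous_fst) continuous_snd
  have hdisj : Disjoint {w : E × ℝ | q w.1 < w.2} (C ×ˢ Set.Iic (0 : ℝ)) := by
    rw [Set.disjoint_left]
    rintro ⟨z, t⟩ h1 ⟨hz, ht⟩
    have := hmin z hz
    simp only [Set.mem_ofPred_eq, Set.mem_Iic, hq] at h1 ht
    linarith
  obtain ⟨ℓ, u, h1, h2⟩ := geometric_hahn_banach_open hU hUo (hC.prod (convex_Iic 0)) hdisj
  set p : E →L[ℝ] ℝ := ℓ.comp (ContinuousLinearMap.inl ℝ E ℝ) with hp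
  set b : ℝ := ℓ (0, 1) with hb
  have hsplit : ∀ z t, ℓ (z, t) = p z + t * b := by
    intro z t
    have : ((z, t) : E × ℝ) = (z, 0) + t • (0, 1) := by simp
    rw [this, map_add, map_smul, smul_eq_mul]
    rfl
  -- The separating hyperplane is not vertical: `(x, 1)` and `(x, 0)` lie on different sides and
  -- differ only in height.
  have hbneg : b < 0 := by
    have e1 := h1 (x, 1) (by simp [hq0])
    have e2 := h2 (x, 0) ⟨hx, by simp⟩
    rw [hsplit] at e1 e2
    linarith
  have hbd : ∀ z, p z + q z * b ≤ u := by
    intro z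
    refine le_of_forall_pos_le_add fun δ hδ => ?_
    have e := h1 (z, q z + δ / (-b)) (by
      have : 0 < δ / (-b) := div_pos hδ (by linarith)
      simp [this])
    rw [hsplit, add_mul] at e
    have : δ / (-b) * b = -δ := by
      rw [div_mul_eq_mul_div, div_neg, mul_div_assoc, div_self hbneg.ne, mul_one]
    linarith
  have hCu : ∀ z ∈ C, u ≤ p z := by
    intro z hz
    have := h2 (z, 0) ⟨hz, by simp⟩
    rwa [hsplit, zero_mul, add_zero] at this
  have hpu : p x = u := by
    have e1 := hbd x
    rw [hq0, zero_mul, add_zero] at e1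
    exact le_antisymm e1 (hCu x hx)
  -- Normalized to slope form, the hyperplane gives a subgradient `w` of `q` at `x` with `⟨w, z - x⟩
  -- ≥ 0` on `C`; removing the linear part `a` leaves a subgradient of `φ`.
  set w : E := (-b)⁻¹ • (InnerProductSpace.toDual ℝ E).symm p with hw
  have hwp : ∀ z, inner ℝ w z = (-b)⁻¹ * p z := by
    intro z
    rw [hw, real_inner_smul_left, InnerProductSpace.toDual_symm_apply]
  have hbi : (0 : ℝ) < (-b)⁻¹ := inv_pos.2 (by linarith)
  refine ⟨w - a, fun z => ?_, fun z hz => ?_⟩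
  · have e := mul_le_mul_of_nonneg_left (hbd z) hbi.le
    rw [← hpu, mul_add] at e
    have e2 : (-b)⁻¹ * (q z * b) = -q z := by
      rw [inv_neg, mul_comm (q z) b, neg_mul, ← mul_assoc, inv_mul_cancel₀ hbneg.ne, one_mul]
    rw [e2] at e
    rw [inner_sub_left, inner_sub_right w, hwp, hwp]
    simp only [hq] at e
    linarith
  · rw [add_sub_cancel, inner_sub_right, hwp, hwp, hpu, ← mul_sub]
    exact mul_nonneg hbi.le (sub_nonneg.2 (hCu z hz))

theorem exists_isSubgrad [CompleteSpace E] {φ : E → ℝ} (hφ : ConvexOn ℝ Set.univ φ)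
    (hc : Continuous φ) (x : E) : ∃ v, IsSubgrad φ x v := by
  obtain ⟨v, hv, -⟩ := exists_isSubgrad_of_forall_le hφ hc (convex_singleton x)
    (Set.mem_singleton x) (a := 0) (by simp)
  exact ⟨v, hv⟩

/-- The subgradients of a continuous function at the points of a ball are bounded. -/
theorem exists_norm_isSubgrad_le [ProperSpace E] {φ : E → ℝ} (hc : Continuous φ) (R : ℝ) :
    ∃ B, 0 ≤ B ∧ ∀ x v, ‖x‖ ≤ R → IsSubgrad φ x v → ‖v‖ ≤ B := by
  obtain ⟨D, hD⟩ := (isCompact_closedBall (0 : E) (R + 1)).exists_bound_of_continuousOn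
    hc.continuousOn
  refine ⟨max (2 * D) 0, le_max_right _ _, fun x v hx hv => ?_⟩
  by_cases hv0 : v = 0
  · simp [hv0]
  have hn : 0 < ‖v‖ := norm_pos_iff.2 hv0
  -- A unit step in the direction of `v` raises `φ` by at least `‖v‖` and stays in the ball of
  -- radius `R + 1`, where `|φ| ≤ D`.
  have h := hv (x + ‖v‖⁻¹ • v)
  rw [add_sub_cancel_left, real_inner_smul_right, real_inner_self_eq_norm_sq, sq, ← mul_assoc,
    inv_mul_cancel₀ hn.ne', one_mul] at h
  have h1 := hD x (by simp; linarith)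
  have h2 := hD (x + ‖v‖⁻¹ • v) (by
    simp only [Metric.mem_closedBall, dist_zero_right]
    refine (norm_add_le _ _).trans ?_
    rw [norm_smul, norm_inv, norm_norm, inv_mul_cancel₀ hn.ne']
    linarith)
  rw [Real.norm_eq_abs] at h1 h2
  have := le_abs_self (φ (x + ‖v‖⁻¹ • v))
  have := neg_abs_le (φ x)
  exact le_max_of_le_left (by linarith)

theorem conjugate_eq_of_isSubgrad {ψ : E → ℝ} {s v : E} (h : IsSubgrad ψ s v) :
    conjugate ψ v = ((inner ℝ v s - ψ s : ℝ) : EReal) := by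
  refine le_antisymm (iSup_le fun z => ?_) (le_iSup (fun x => ((inner ℝ v x - ψ x : ℝ) : EReal)) s)
  rw [EReal.coe_le_coe_iff]
  have := h z
  rw [inner_sub_right] at this
  linarith

theorem le_conjugate (ψ : E → ℝ) (s v : E) :
    ((inner ℝ v s - ψ s : ℝ) : EReal) ≤ conjugate ψ v :=
  le_iSup (fun x => ((inner ℝ v x - ψ x : ℝ) : EReal)) s

end Subgradients

/-! ### The orthant and its normal cone -/

section Orthant

variable {m : ℕ}

theorem isClosed_nonposOrthant : IsClosed (nonposOrthant m) := by
  have : nonposOrthant m = ⋂ i, {y : Vec m | y i ≤ 0} := by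
    ext; simp [nonposOrthant]
  rw [this]
  exact isClosed_iInter fun i => isClosed_le (by fun_prop) continuous_const

theorem convex_nonposOrthant : Convex ℝ (nonposOrthant m) := by
  intro x hx y hy s t hs ht _ i
  have := mul_nonpos_of_nonneg_of_nonpos hs (hx i)
  have := mul_nonpos_of_nonneg_of_nonpos ht (hy i)
  simp only [PiLp.add_apply, PiLp.smul_apply, smul_eq_mul]
  linarith

theorem inner_eq_sum (x y : Vec m) : inner ℝ x y = ∑ i, x i * y i := by
  simp [PiLp.inner_apply, mul_comm]

theorem inner_nonpos_of_mem_nonposOrthant {l y : Vec m} (hl : ∀ i, 0 ≤ l i)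
    (hy : y ∈ nonposOrthant m) : inner ℝ l y ≤ 0 := by
  rw [inner_eq_sum]
  exact Finset.sum_nonpos fun i _ => mul_nonpos_of_nonneg_of_nonpos (hl i) (hy i)

/-- The normal cone of the non-positive orthant. -/
theorem mem_normalCone_nonposOrthant_iff {l y : Vec m} :
    l ∈ normalCone (nonposOrthant m) y ↔
      y ∈ nonposOrthant m ∧ (∀ i, 0 ≤ l i) ∧ inner ℝ l y = 0 := by
  constructor
  · intro h
    obtain ⟨hy, h⟩ := mem_and_inner_le_zero_of_mem_normalCone convex_nonposOrthant h
    have hl : ∀ i, 0 ≤ l i := by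
      intro i
      -- Decreasing one coordinate stays in the orthant and gives the sign of `l i`; the test point
      -- `0` below gives complementarity.
      have := h (y - EuclideanSpace.single i 1) (by
        intro j
        have := hy j
        by_cases hij : j = i
        · subst hij; simp; linarith
        · simp [hij, this])
      simpa [EuclideanSpace.inner_single_right] using this
    refine ⟨hy, hl, le_antisymm (inner_nonpos_of_mem_nonposOrthant hl hy) ?_⟩
    have := h 0 (by intro i; simp)
    simpa using this
  · rintro ⟨hy, hl, h0⟩
    refine mem_normalCone_of_forall hy fun z hz => ?_
    rw [inner_sub_right, h0, sub_zero]
    exact inner_nonpos_of_mem_nonposOrthant hl hz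

end Orthant

/-! ### Uniform estimates on compact sets -/

section Calculus

/-- On a compact set, a function with locally Lipschitz derivative satisfies a uniform quadratic
estimate, and its derivative is Lipschitz. -/
theorem exists_quadratic_bound {E F : Type*} [NormedAddCommGroup E] [NormedSpace ℝ E]
    [NormedAddCommGroup F] [NormedSpace ℝ F] {H : E → F} {H' : E → E →L[ℝ] F} {O K : Set E}
    (hO : IsOpen O) (hH : ∀ x ∈ O, HasFDerivAt H (H' x) x) (hL : LocallyLipschitzOn O H')
    (hK : IsCompact K) (hKO : K ⊆ O) :
    ∃ C, 0 ≤ C ∧ ∀ x ∈ K, ∀ x' ∈ K, ‖H x' - H x - H' x (x' - x)‖ ≤ C * ‖x' - x‖ ^ 2 ∧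
      ‖H' x' - H' x‖ ≤ C * ‖x' - x‖ := by
  have hcH : ContinuousOn H K := fun x hx => (hH x (hKO hx)).continuousAt.continuousWithinAt
  have hcH' : ContinuousOn H' K := hL.continuousOn.mono hKO
  have h1 : ContinuousOn (fun z : E × E => z.1) (K ×ˢ K) := continuousOn_fst
  have h2 : ContinuousOn (fun z : E × E => z.2) (K ×ˢ K) := continuousOn_snd
  have hc1 : ContinuousOn (fun z : E × E => H z.1) (K ×ˢ K) := hcH.comp h1 fun z hz => hz.1
  have hc2 : ContinuousOn (fun z : E × E => H z.2) (K ×ˢ K) := hcH.comp h2 fun z hz => hz.2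
  have hc1' : ContinuousOn (fun z : E × E => H' z.1) (K ×ˢ K) := hcH'.comp h1 fun z hz => hz.1
  have hc2' : ContinuousOn (fun z : E × E => H' z.2) (K ×ˢ K) := hcH'.comp h2 fun z hz => hz.2
  obtain ⟨M₁, hM₁⟩ := (hK.prod hK).exists_bound_of_continuousOn
    ((hc2.sub hc1).sub (hc1'.clm_apply (h2.sub h1)))
  obtain ⟨M₂, hM₂⟩ := (hK.prod hK).exists_bound_of_continuousOn (hc2'.sub hc1')
  suffices h : ∃ C, 0 ≤ C ∧ ∀ z ∈ K ×ˢ K,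
      ‖H z.2 - H z.1 - H' z.1 (z.2 - z.1)‖ ≤ C * ‖z.2 - z.1‖ ^ 2 ∧
        ‖H' z.2 - H' z.1‖ ≤ C * ‖z.2 - z.1‖ by
    obtain ⟨C, hC, h⟩ := h
    exact ⟨C, hC, fun x hx x' hx' => h (x, x') ⟨hx, hx'⟩⟩
  -- `K` need not be convex, so no mean value inequality applies to it as a whole. The estimate is
  -- local on `K × K`, and compactness patches the constants.
  refine (hK.prod hK).induction_on (p := fun S => ∃ C, 0 ≤ C ∧ ∀ z ∈ S,
      ‖H z.2 - H z.1 - H' z.1 (z.2 - z.1)‖ ≤ C * ‖z.2 - z.1‖ ^ 2 ∧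
        ‖H' z.2 - H' z.1‖ ≤ C * ‖z.2 - z.1‖) ⟨0, le_rfl, by simp⟩ ?_ ?_ ?_
  · rintro s t hst ⟨C, hC, h⟩
    exact ⟨C, hC, fun z hz => h z (hst hz)⟩
  · rintro s t ⟨C, hC, h⟩ ⟨D, hD, h'⟩
    refine ⟨max C D, le_max_of_le_left hC, fun z hz => ?_⟩
    rcases hz with hz | hz
    · exact ⟨(h z hz).1.trans (by gcongr; exact le_max_left _ _),
        (h z hz).2.trans (by gcongr; exact le_max_left _ _)⟩
    · exact ⟨(h' z hz).1.trans (by gcongr; exact le_max_right _ _),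
        (h' z hz).2.trans (by gcongr; exact le_max_right _ _)⟩
  · rintro ⟨a, b⟩ ⟨ha, hb⟩
    by_cases hab : a = b
    · subst hab
      obtain ⟨L, t, ht, hLt⟩ := hL (hKO ha)
      rw [hO.nhdsWithin_eq (hKO ha)] at ht
      obtain ⟨r, hr, hball⟩ := Metric.mem_nhds_iff.1 (inter_mem ht (hO.mem_nhds (hKO ha)))
      refine ⟨_, mem_nhdsWithin_of_mem_nhds (prod_mem_nhds (Metric.ball_mem_nhds a hr)
        (Metric.ball_mem_nhds a hr)), L, L.2, ?_⟩
      rintro ⟨x, x'⟩ ⟨hx, hx'⟩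
      have hlip : ∀ z ∈ Metric.ball a r, ‖H' z - H' x‖ ≤ L * ‖z - x‖ := fun z hz =>
        hLt.norm_sub_le (hball hz).1 (hball hx).1
      refine ⟨?_, hlip x' hx'⟩
      -- On this convex set `H'` deviates from `H' x` by at most `L ‖x' - x‖`, so the mean value
      -- inequality produces the square.
      have hconv : Convex ℝ (Metric.ball a r ∩ Metric.closedBall x ‖x' - x‖) :=
        (convex_ball a r).inter (convex_closedBall x _)
      have := hconv.norm_image_sub_le_of_norm_hasFDerivWithin_le' (f := H) (f' := H')
        (φ := H' x) (C := L * ‖x' - x‖) (x := x) (y := x')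
        (fun z hz => (hH z (hball hz.1).2).hasFDerivWithinAt)
        (fun z hz => (hlip z hz.1).trans (by
          have := hz.2
          rw [Metric.mem_closedBall, dist_eq_norm] at this
          gcongr))
        ⟨hx, by simp⟩ ⟨hx', by simp [dist_eq_norm]⟩
      simpa [sq, mul_assoc] using this
    -- Off the diagonal `‖x' - x‖` is bounded below by `d`, and the bounds `M₁`, `M₂` over the whole
    -- compact set suffice.
    · set d : ℝ := ‖b - a‖ / 2 with hd
      have hd0 : 0 < d := by
        have : 0 < ‖b - a‖ := norm_pos_iff.2 (sub_ne_zero.2 (Ne.symm hab))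
        positivity
      have hnear : ∀ᶠ z : E × E in 𝓝 (a, b), d < ‖z.2 - z.1‖ := by
        have hcont : Continuous fun z : E × E => ‖z.2 - z.1‖ := by fun_prop
        refine (hcont.tendsto (a, b)).eventually (lt_mem_nhds ?_)
        change d < ‖b - a‖
        linarith
      have hM1 : 0 ≤ M₁ := (norm_nonneg _).trans (hM₁ (a, b) ⟨ha, hb⟩)
      have hM2 : 0 ≤ M₂ := (norm_nonneg _).trans (hM₂ (a, b) ⟨ha, hb⟩)
      refine ⟨_, inter_mem_nhdsWithin _ hnear, M₁ / d ^ 2 + M₂ / d, by positivity, ?_⟩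
      rintro z ⟨hz, hdz⟩
      have hdz : d < ‖z.2 - z.1‖ := hdz
      constructor
      · refine (hM₁ z hz).trans ?_
        calc M₁ = M₁ / d ^ 2 * d ^ 2 := by field_simp
          _ ≤ (M₁ / d ^ 2 + M₂ / d) * ‖z.2 - z.1‖ ^ 2 := by
            gcongr
            exact le_add_of_nonneg_right (by positivity)
      · refine (hM₂ z hz).trans ?_
        calc M₂ = M₂ / d * d := by field_simp
          _ ≤ (M₁ / d ^ 2 + M₂ / d) * ‖z.2 - z.1‖ := by
            gcongr
            exact le_add_of_nonneg_left (by positivity)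

/-- A sequence in a compact set is eventually covered by finitely many given neighbourhoods of its
cluster points. -/
theorem exists_finset_cover_clusterSet {X : Type*} [TopologicalSpace X] {s : ℕ → X} {K : Set X}
    (hK : IsCompact K) (hs : ∀ᶠ k in atTop, s k ∈ K) {V : X → Set X}
    (hV : ∀ q ∈ clusterSet s, V q ∈ 𝓝 q) :
    ∃ T : Finset X, (∀ q ∈ T, q ∈ clusterSet s) ∧ ∀ᶠ k in atTop, ∃ q ∈ T, s k ∈ V q := by
  classical
  have : ∃ T : Finset X, (∀ q ∈ T, q ∈ clusterSet s) ∧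
      ∀ᶠ k in atTop, s k ∈ K → ∃ q ∈ T, s k ∈ V q := by
    refine hK.induction_on (p := fun S => ∃ T : Finset X, (∀ q ∈ T, q ∈ clusterSet s) ∧
      ∀ᶠ k in atTop, s k ∈ S → ∃ q ∈ T, s k ∈ V q) ⟨∅, by simp, by simp⟩ ?_ ?_ ?_
    · rintro S S' hSS ⟨T, hT, h⟩
      exact ⟨T, hT, h.mono fun k hk hkS => hk (hSS hkS)⟩
    · rintro S S' ⟨T, hT, h⟩ ⟨T', hT', h'⟩
      refine ⟨T ∪ T', fun q hq => ?_, ?_⟩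
      · rcases Finset.mem_union.1 hq with hq | hq
        exacts [hT q hq, hT' q hq]
      · filter_upwards [h, h'] with k hk hk' hkS
        rcases hkS with hkS | hkS
        · obtain ⟨q, hq, hqV⟩ := hk hkS
          exact ⟨q, Finset.mem_union_left _ hq, hqV⟩
        · obtain ⟨q, hq, hqV⟩ := hk' hkS
          exact ⟨q, Finset.mem_union_right _ hq, hqV⟩
    · intro q _
      -- A point that is not a cluster point has a neighbourhood that the sequence eventually
      -- avoids, so it contributes no index.
      by_cases hq : q ∈ clusterSet s
      · exact ⟨V q, mem_nhdsWithin_of_mem_nhds (hV q hq), {q}, by simpa using hq,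
          Eventually.of_forall fun k hk => ⟨q, by simp, hk⟩⟩
      · have hq' : ¬ ∀ W ∈ 𝓝 q, ∃ᶠ k in atTop, s k ∈ W := fun h =>
          hq (mapClusterPt_iff_frequently.2 h)
        push Not at hq'
        obtain ⟨W, hW, h⟩ := hq'
        refine ⟨W, mem_nhdsWithin_of_mem_nhds hW, ∅, by simp, ?_⟩
        filter_upwards [h] with k hk hkW
        exact absurd hkW hk
  obtain ⟨T, hT, h⟩ := this
  exact ⟨T, hT, by filter_upwards [h, hs] with k hk hks using hk hks⟩

end Calculus

/-! ### Summability from the Kurdyka-Łojasiewicz inequality -/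

section KL

/-- A chord of a concave function is at least as steep as the tangent at its right end. The left end
may be `0`, where `θ` need not be differentiable. -/
theorem IsDesingularizing.deriv_mul_le {η : EReal} {θ : ℝ → ℝ} (h : IsDesingularizing η θ)
    {s t : ℝ} (hs : 0 ≤ s) (hst : s ≤ t) (ht : (t : EReal) < η) (ht0 : 0 < t) :
    deriv θ t * (t - s) ≤ θ t - θ s := by
  rcases hst.eq_or_lt with rfl | hlt
  · simp
  have hsη : (s : EReal) < η := (EReal.coe_le_coe_iff.2 hst).trans_lt ht
  have := h.concaveOn.deriv_le_slope ⟨hs, hsη⟩ ⟨ht0.le, ht⟩ hlt (h.differentiableAt t ⟨ht0.le, ht⟩ ht0)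
  rw [slope_def_field, le_div_iff₀ (by linarith)] at this
  exact this

theorem IsDesingularizing.deriv_anti {η : EReal} {θ : ℝ → ℝ} (h : IsDesingularizing η θ)
    {s t : ℝ} (hs : 0 < s) (hst : s ≤ t) (ht : (t : EReal) < η) : deriv θ t ≤ deriv θ s := by
  rcases hst.eq_or_lt with rfl | hlt
  · rfl
  have hsη : (s : EReal) < η := (EReal.coe_le_coe_iff.2 hst).trans_lt ht
  have ht0 := hs.trans hlt
  exact (h.concaveOn.deriv_le_slope ⟨hs.le, hsη⟩ ⟨ht0.le, ht⟩ hlt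
    (h.differentiableAt t ⟨ht0.le, ht⟩ ht0)).trans
    (h.concaveOn.slope_le_deriv ⟨hs.le, hsη⟩ ⟨ht0.le, ht⟩ hlt
      (h.differentiableAt s ⟨hs.le, hsη⟩ hs))

theorem IsDesingularizing.mono {η : EReal} {θ : ℝ → ℝ} (h : IsDesingularizing η θ)
    {s t : ℝ} (hs : 0 ≤ s) (hst : s ≤ t) (ht : (t : EReal) < η) : θ s ≤ θ t := by
  rcases hst.eq_or_lt with rfl | hlt
  · rfl
  have ht0 := hs.trans_lt hlt
  have h1 := h.deriv_mul_le hs hst ht ht0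
  have h2 := h.deriv_pos t ⟨ht0.le, ht⟩ ht0
  have : 0 ≤ deriv θ t * (t - s) := mul_nonneg h2.le (by linarith)
  linarith

/-- On summation the differences of `S` telescope and half of the sum of `D` is absorbed into the
left side. -/
theorem summable_of_le_half_add_sub {D S : ℕ → ℝ} (hD : ∀ k, 0 ≤ D k) (hS : ∀ k, 0 ≤ S k) {K : ℕ}
    (h : ∀ k ≥ K, D (k + 1) ≤ D k / 2 + (S k - S (k + 1))) : Summable D := by
  rw [← summable_nat_add_iff K]
  refine summable_of_sum_range_le (c := 2 * (D K + S K)) (fun k => hD _) fun N => ?_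
  have h1 : ∑ i ∈ Finset.range N, D (i + 1 + K) ≤
      (∑ i ∈ Finset.range N, D (i + K)) / 2 + (S K - S (N + K)) := by
    induction N with
    | zero => simp
    | succ N ih =>
      rw [Finset.sum_range_succ, Finset.sum_range_succ]
      have := h (N + K) (by omega)
      rw [show N + 1 + K = N + K + 1 by ring]
      linarith
  have h2 : ∑ i ∈ Finset.range (N + 1), D (i + K) =
      ∑ i ∈ Finset.range N, D (i + 1 + K) + D (0 + K) :=
    Finset.sum_range_succ' (fun i => D (i + K)) N
  rw [Finset.sum_range_succ, zero_add] at h2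
  have := hS (N + K)
  have := hD (N + K)
  linarith

/-- If the decrease of a null sequence `r` dominates `D ^ 2`, and `1 / D k` is bounded by derivatives
of finitely many desingularizing functions at points above `r (k + 1)`, then `D` is summable. -/
theorem summable_of_desingularizing {ι : Type*} (T : Finset ι) {η : ι → EReal} {θ : ι → ℝ → ℝ}
    (hη : ∀ i ∈ T, 0 < η i) (hθ : ∀ i ∈ T, IsDesingularizing (η i) (θ i)) {D r : ℕ → ℝ} {a b : ℝ}
    (ha : 0 < a) (hb : 0 < b) (hD : ∀ k, 0 ≤ D k) (hr : ∀ k, 0 ≤ r k)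
    (hr0 : Tendsto r atTop (𝓝 0)) (hdec : ∀ k, a * D k ^ 2 ≤ r k - r (k + 1))
    (hKL : ∀ᶠ k in atTop, 0 < r (k + 1) → ∃ i ∈ T, ∃ e, r (k + 1) ≤ e ∧ (e : EReal) < η i ∧
      1 ≤ deriv (θ i) e * (b * D k)) : Summable D := by
  have hanti : Antitone r := antitone_nat_of_succ_le fun k => by
    have : 0 ≤ a * D k ^ 2 := by positivity
    linarith [hdec k]
  by_cases hz : ∃ K, r K = 0
  -- Once `r` reaches `0` it stays there and all later `D k` vanish. Otherwise every `r k` is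
  -- positive and `θ'` can be evaluated at it.
  · obtain ⟨K, hK⟩ := hz
    refine summable_of_hasFiniteSupport ((Set.finite_lt_nat K).subset fun k hk => ?_)
    by_contra hkK
    have hkK : K ≤ k := not_lt.1 hkK
    have h1 : r k = 0 := le_antisymm (hK ▸ hanti hkK) (hr k)
    have h2 := hdec k
    have h3 := hr (k + 1)
    have hDk : 0 < D k := lt_of_le_of_ne (hD k) (Ne.symm hk)
    have : 0 < a * D k ^ 2 := by positivity
    linarith
  push Not at hz
  have hpos : ∀ k, 0 < r k := fun k => lt_of_le_of_ne (hr k) (Ne.symm (hz k))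
  have hmem : ∀ᶠ k in atTop, ∀ i ∈ T, (r k : EReal) < η i := by
    rw [Filter.eventually_all_finset]
    intro i hi
    exact ((continuous_coe_real_ereal.tendsto 0).comp hr0).eventually (gt_mem_nhds (hη i hi))
  obtain ⟨K, hK⟩ := eventually_atTop.1 (hKL.and hmem)
  -- The index `i` may change with `k`, so the telescoping quantity sums over all of `T`; the other
  -- summands also decrease along `r` because each `θ j` is increasing. The shift by one matches `D
  -- (l + 1)`, which is controlled by `r (l + 1) - r (l + 2)`.
  set S : ℕ → ℝ := fun k => b / (2 * a) * ∑ i ∈ T, θ i (r (k + K + 1)) with hS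
  rw [← summable_nat_add_iff K]
  refine summable_of_le_half_add_sub (S := S) (K := 0) (fun k => hD _) (fun k => ?_) fun k _ => ?_
  · exact mul_nonneg (by positivity) (Finset.sum_nonneg fun i hi =>
      (hθ i hi).nonneg _ ⟨hr _, (hK _ (by omega)).2 i hi⟩)
  · obtain ⟨i, hi, e, hre, heη, h1⟩ := (hK (k + K) (by omega)).1 (hpos _)
    rw [show k + 1 + K = k + K + 1 by ring]
    set l := k + K with hl
    have hη1 : ∀ j ∈ T, (r (l + 1) : EReal) < η j := (hK (l + 1) (by omega)).2
    have hd : 1 ≤ deriv (θ i) (r (l + 1)) * (b * D l) :=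
      h1.trans (mul_le_mul_of_nonneg_right ((hθ i hi).deriv_anti (hpos _) hre heη)
        (mul_nonneg hb.le (hD _)))
    have hX : deriv (θ i) (r (l + 1)) * (a * D (l + 1) ^ 2) ≤
        ∑ j ∈ T, (θ j (r (l + 1)) - θ j (r (l + 2))) := by
      refine le_trans ?_ (Finset.single_le_sum
        (f := fun j => θ j (r (l + 1)) - θ j (r (l + 2))) (fun j hj => ?_) hi)
      · refine le_trans ?_ ((hθ i hi).deriv_mul_le (hr _) (hanti (Nat.le_succ _)) (hη1 i hi)
          (hpos _))
        exact mul_le_mul_of_nonneg_left (hdec _)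
          ((hθ i hi).deriv_pos _ ⟨hr _, hη1 i hi⟩ (hpos _)).le
      · exact sub_nonneg.2 ((hθ j hj).mono (hr _) (hanti (Nat.le_succ _)) (hη1 j hj))
    set X := ∑ j ∈ T, (θ j (r (l + 1)) - θ j (r (l + 2))) with hXdef
    have hSd : S k - S (k + 1) = b / (2 * a) * X := by
      simp only [hS]
      rw [← mul_sub, hXdef, Finset.sum_sub_distrib, show k + 1 + K + 1 = l + 2 by omega]
    rw [hSd]
    have hX0 : 0 ≤ X := le_trans (mul_nonneg ((hθ i hi).deriv_pos _ ⟨hr _, hη1 i hi⟩ (hpos _)).le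
      (by positivity)) hX
    set Y := b / a * X with hY
    have hY0 : 0 ≤ Y := by positivity
    have hsq : D (l + 1) ^ 2 ≤ Y * D l := by
      have e1 : a * D (l + 1) ^ 2 * 1 ≤
          a * D (l + 1) ^ 2 * (deriv (θ i) (r (l + 1)) * (b * D l)) :=
        mul_le_mul_of_nonneg_left hd (by positivity)
      have e2 : deriv (θ i) (r (l + 1)) * (a * D (l + 1) ^ 2) * (b * D l) ≤ X * (b * D l) :=
        mul_le_mul_of_nonneg_right hX (mul_nonneg hb.le (hD _))
      have e3 : a * D (l + 1) ^ 2 ≤ a * (Y * D l) := by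
        have : a * (Y * D l) = X * (b * D l) := by rw [hY]; field_simp
        rw [this]; linarith
      exact le_of_mul_le_mul_left e3 ha
    have : b / (2 * a) * X = Y / 2 := by rw [hY]; field_simp
    rw [this]
    -- Arithmetic-geometric mean: `Y * D l ≤ ((Y + D l) / 2) ^ 2`.
    refine le_of_sq_le_sq ?_ (by have := hD l; positivity)
    nlinarith [sq_nonneg (Y - D l)]

end KL

/-! ### The subproblems -/

section Subproblem

variable {n m : ℕ}

theorem inner_jacT (H : Vec n → Vec m) (x h : Vec n) (l : Vec m) :
    inner ℝ (jacT H x l) h = inner ℝ l (fderiv ℝ H x h) :=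
  ContinuousLinearMap.adjoint_inner_left _ _ _

/-- Expansion of the moving balls model around a point. -/
theorem ballMap_eq_add (g : Vec n → Vec m) (z x s : Vec n) (L : Vec m) :
    ballMap g z s L = ballMap g x s L + (fderiv ℝ g s (z - x) + inner ℝ (x - s) (z - x) • L)
      + ((1 / 2 : ℝ) * ‖z - x‖ ^ 2) • L := by
  have h1 : z - s = (x - s) + (z - x) := by abel
  have h2 : ‖z - s‖ ^ 2 = ‖x - s‖ ^ 2 + 2 * inner ℝ (x - s) (z - x) + ‖z - x‖ ^ 2 := by
    rw [h1, norm_add_sq_real]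
  unfold ballMap
  rw [h2, h1, map_add]
  module

theorem fderiv_ballMap_apply (g : Vec n → Vec m) (x s h : Vec n) (L : Vec m) :
    fderiv ℝ (fun z => ballMap g z s L) x h = fderiv ℝ g s h + inner ℝ (x - s) h • L := by
  have h1 : HasFDerivAt (fun z : Vec n => z - s) (ContinuousLinearMap.id ℝ (Vec n)) x :=
    (hasFDerivAt_id x).sub_const s
  have h2 := ((fderiv ℝ g s).hasFDerivAt.comp x h1).const_add (g s)
  have h3 := ((h1.norm_sq).const_mul (1 / 2 : ℝ)).smul_const L
  have h4 : HasFDerivAt (fun z => ballMap g z s L) _ x := h2.add h3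
  rw [h4.fderiv]
  simp [inner_sub_left]

theorem jacT_ballMap (g : Vec n → Vec m) (x s : Vec n) (L l : Vec m) :
    jacT (fun z => ballMap g z s L) x l = jacT g s l + inner ℝ l L • (x - s) := by
  refine ext_inner_right ℝ fun h => ?_
  rw [inner_jacT, fderiv_ballMap_apply, inner_add_left, inner_jacT, inner_add_right,
    real_inner_smul_left, real_inner_smul_right, mul_comm]

/-- Each component of the model is affine plus `(L i / 2) ‖· - s‖²`. Expanding at the convex
combination `w`, the linear parts cancel and the quadratic remainders are nonnegative. -/
theorem convex_subFeasible (g : Vec n → Vec m) (s : Vec n) {L : Vec m} (hL : ∀ i, 0 ≤ L i) :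
    Convex ℝ (subFeasible g s L) := by
  intro x hx y hy t u ht hu htu i
  set w := t • x + u • y with hw
  have hw0 : t • (x - w) + u • (y - w) = 0 := by
    have : t • (x - w) + u • (y - w) = (t • x + u • y) - (t + u) • w := by module
    rw [this, htu, one_smul, ← hw, sub_self]
  have ex := congrArg (fun a : Vec m => a i) (ballMap_eq_add g x w s L)
  have ey := congrArg (fun a : Vec m => a i) (ballMap_eq_add g y w s L)
  have hA : t * (fderiv ℝ g s (x - w) + inner ℝ (w - s) (x - w) • L) i
      + u * (fderiv ℝ g s (y - w) + inner ℝ (w - s) (y - w) • L) i = 0 := by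
    have : t • (fderiv ℝ g s (x - w) + inner ℝ (w - s) (x - w) • L)
        + u • (fderiv ℝ g s (y - w) + inner ℝ (w - s) (y - w) • L) =
        fderiv ℝ g s (t • (x - w) + u • (y - w))
          + inner ℝ (w - s) (t • (x - w) + u • (y - w)) • L := by
      rw [map_add, map_smul, map_smul, inner_add_right, inner_smul_right, inner_smul_right]
      module
    rw [hw0, map_zero, inner_zero_right, zero_smul, add_zero] at this
    simpa only [PiLp.add_apply, PiLp.smul_apply, smul_eq_mul, PiLp.zero_apply] using
      congrArg (fun a : Vec m => a i) this
  have hxi : ballMap g x s L i ≤ 0 := hx i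
  have hyi : ballMap g y s L i ≤ 0 := hy i
  simp only [PiLp.add_apply, PiLp.smul_apply, smul_eq_mul] at ex ey hA
  have p1 : 0 ≤ t * (1 / 2 * ‖x - w‖ ^ 2 * L i) := by have := hL i; positivity
  have p2 : 0 ≤ u * (1 / 2 * ‖y - w‖ ^ 2 * L i) := by have := hL i; positivity
  have q1 := mul_nonpos_of_nonneg_of_nonpos ht hxi
  have q2 := mul_nonpos_of_nonneg_of_nonpos hu hyi
  rw [ex] at q1
  rw [ey] at q2
  have : ballMap g w s L i = t * ballMap g w s L i + u * ballMap g w s L i := by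
    rw [← add_mul, htu, one_mul]
  rw [this]
  linarith

/-- Nonnegative multipliers give convex Lagrangian terms. -/
theorem inner_ballMap_ge (g : Vec n → Vec m) (z x s : Vec n) {L l : Vec m} (hL : ∀ i, 0 ≤ L i)
    (hl : ∀ i, 0 ≤ l i) :
    inner ℝ l (ballMap g x s L) + inner ℝ (jacT (fun w => ballMap g w s L) x l) (z - x)
      ≤ inner ℝ l (ballMap g z s L) := by
  rw [inner_jacT, fderiv_ballMap_apply, ballMap_eq_add g z x s L, inner_add_right, inner_add_right,
    inner_add_right l (ballMap g x s L), inner_add_right l (fderiv ℝ g s (z - x))]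
  have : 0 ≤ inner ℝ l ((1 / 2 * ‖z - x‖ ^ 2) • L) := by
    rw [inner_smul_right, inner_eq_sum]
    exact mul_nonneg (by positivity) (Finset.sum_nonneg fun i _ => mul_nonneg (hl i) (hL i))
  linarith

/-- Bounds what an infeasible point can gain in the Lagrangian. The factor `m` is the number of
summands, each estimated by the sup norm of the violation. -/
theorem inner_le_mul_norm_posPart {l y : Vec m} (hl : ∀ i, 0 ≤ l i) :
    inner ℝ l y ≤ m * ‖l‖ * ‖(fun i => max (y i) 0 : Fin m → ℝ)‖ := by
  rw [inner_eq_sum]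
  have : ∀ i ∈ Finset.univ, l i * y i ≤ ‖l‖ * ‖(fun i => max (y i) 0 : Fin m → ℝ)‖ := by
    intro i _
    have h1 : l i ≤ ‖l‖ := (le_abs_self _).trans (PiLp.norm_apply_le l i)
    have h2 : max (y i) 0 ≤ ‖(fun i => max (y i) 0 : Fin m → ℝ)‖ :=
      (le_abs_self _).trans (norm_le_pi_norm (fun i => max (y i) 0 : Fin m → ℝ) i)
    calc l i * y i ≤ l i * max (y i) 0 := mul_le_mul_of_nonneg_left (le_max_left _ _) (hl i)
      _ ≤ _ := mul_le_mul h1 h2 (le_max_right _ _) (norm_nonneg _)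
  refine (Finset.sum_le_sum this).trans ?_
  simp [mul_assoc]

variable {f : Vec n → EReal} {φ ψ : Vec n → ℝ} {g : Vec n → Vec m} {s ξ x : Vec n}
  {Q : Vec n →L[ℝ] Vec n} {L : Vec m}

/-- Expansion of the subproblem's objective around a point. -/
theorem subObj_sub (hQ : (Q : Vec n →ₗ[ℝ] Vec n).IsSymmetric) (z : Vec n) :
    subObj f φ ψ s ξ Q z - subObj f φ ψ s ξ Q x =
      inner ℝ (grad f s + ξ + Q (x - s)) (z - x) + (1 / 2 : ℝ) * inner ℝ (z - x) (Q (z - x))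
        + φ z - φ x := by
  have h1 : z - s = (x - s) + (z - x) := by abel
  have h2 : inner ℝ (z - x) (Q (x - s)) = inner ℝ (x - s) (Q (z - x)) := by
    rw [real_inner_comm]
    exact hQ (x - s) (z - x)
  unfold subObj quadModel
  rw [h1, map_add, inner_add_left (grad f s + ξ)]
  simp only [inner_add_right, inner_add_left (x - s), h2]
  rw [real_inner_comm (z - x) (Q (x - s)), h2]
  ring

/-- Optimality condition for the subproblem. -/
theorem exists_subproblem_normal (hφ : ConvexOn ℝ Set.univ φ) (hφc : Continuous φ)
    (hQ : (Q : Vec n →ₗ[ℝ] Vec n).IsSymmetric) (hL : ∀ i, 0 ≤ L i)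
    (hx : x ∈ subFeasible g s L) (hmin : IsMinOn (subObj f φ ψ s ξ Q) (subFeasible g s L) x) :
    ∃ v, IsSubgrad φ x v ∧
      -(grad f s + ξ + Q (x - s) + v) ∈ normalCone (subFeasible g s L) x := by
  have hC := convex_subFeasible g s hL
  obtain ⟨v, hv, h⟩ := exists_isSubgrad_of_forall_le (a := grad f s + ξ + Q (x - s)) hφ hφc hC hx
    (fun z hz => by
      refine le_of_forall_pos_le_add fun δ hδ => ?_
      set q : ℝ := inner ℝ (z - x) (Q (z - x)) with hq
      -- Moving a fraction `t` towards `z` makes the quadratic term of order `t²`. After division by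
      -- `t` this choice keeps it below `δ`, leaving the variational inequality for the linearized
      -- objective.
      set t : ℝ := min 1 (δ / (|q| + 1)) with ht
      have ht0 : 0 < t := lt_min one_pos (by positivity)
      have ht1 : t ≤ 1 := min_le_left _ _
      have htq : t * q ≤ δ := by
        calc t * q ≤ t * |q| := mul_le_mul_of_nonneg_left (le_abs_self q) ht0.le
          _ ≤ δ / (|q| + 1) * |q| :=
            mul_le_mul_of_nonneg_right (min_le_right _ _) (abs_nonneg q)
          _ ≤ δ := by
            rw [div_mul_eq_mul_div, div_le_iff₀ (by positivity)]
            nlinarith [abs_nonneg q]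
      have hmem := hC.add_smul_sub_mem hx hz ⟨ht0.le, ht1⟩
      have h0 : 0 ≤ subObj f φ ψ s ξ Q (x + t • (z - x)) - subObj f φ ψ s ξ Q x :=
        sub_nonneg.2 (hmin hmem)
      rw [subObj_sub hQ, add_sub_cancel_left, map_smul, inner_smul_right, real_inner_smul_left,
        inner_smul_right, ← hq] at h0
      have hc := hφ.2 (Set.mem_univ x) (Set.mem_univ z) (sub_nonneg.2 ht1) ht0.le (by ring)
      rw [show (1 - t) • x + t • z = x + t • (z - x) by module, smul_eq_mul, smul_eq_mul] at hc
      have : 0 ≤ t * (inner ℝ (grad f s + ξ + Q (x - s)) (z - x) + (1 / 2) * (t * q)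
          + φ z - φ x) := by nlinarith
      have := nonneg_of_mul_nonneg_right this ht0
      linarith)
  refine ⟨v, hv, mem_normalCone_of_forall hx fun z hz => ?_⟩
  rw [inner_neg_left]
  exact neg_nonpos.2 (h z hz)

/-- Strong convexity of the Lagrangian of the subproblem. -/
theorem norm_sub_sq_le_of_kkt (hQ : (Q : Vec n →ₗ[ℝ] Vec n).IsSymmetric) {μ : ℝ}
    (hμ : ∀ h, μ * ‖h‖ ^ 2 ≤ inner ℝ h (Q h)) (hL : ∀ i, 0 ≤ L i) {v : Vec n} {l : Vec m}
    (hv : IsSubgrad φ x v) (hl : ∀ i, 0 ≤ l i) (hcomp : inner ℝ l (ballMap g x s L) = 0)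
    (hkkt : jacT (fun z => ballMap g z s L) x l = -(grad f s + ξ + Q (x - s) + v)) (y : Vec n) :
    μ / 2 * ‖y - x‖ ^ 2 ≤ subObj f φ ψ s ξ Q y - subObj f φ ψ s ξ Q x
      + inner ℝ l (ballMap g y s L) := by
  -- The point `y` may violate the constraints: the Lagrangian term accounts for it, and its linear
  -- part at `x` cancels the gradient of the objective by stationarity.
  have h1 := inner_ballMap_ge g y x s hL hl
  rw [hcomp, hkkt, inner_neg_left, inner_add_left _ v] at h1
  rw [subObj_sub hQ]
  have := hv y
  have := hμ (y - x)
  linarith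

/-- Points at which the subproblem's objective is at most its value at `s` are near `s`. -/
theorem mul_norm_sub_le_of_subObj_le (hQ : (Q : Vec n →ₗ[ℝ] Vec n).IsSymmetric) {μ : ℝ}
    (hμ : ∀ h, μ * ‖h‖ ^ 2 ≤ inner ℝ h (Q h)) {v y : Vec n} (hv : IsSubgrad φ s v)
    (hle : subObj f φ ψ s ξ Q y ≤ subObj f φ ψ s ξ Q s) :
    μ / 2 * ‖y - s‖ ≤ ‖grad f s‖ + ‖ξ‖ + ‖v‖ := by
  rcases eq_or_ne y s with rfl | hne
  · simp; positivity
  have h0 : 0 < ‖y - s‖ := norm_pos_iff.2 (sub_ne_zero.2 hne)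
  have h1 := subObj_sub (f := f) (φ := φ) (ψ := ψ) (s := s) (ξ := ξ) (x := s) hQ y
  rw [sub_self, map_zero, add_zero] at h1
  have h2 := hv y
  have h3 := hμ (y - s)
  have h4 : -inner ℝ (grad f s + ξ + v) (y - s) ≤ (‖grad f s‖ + ‖ξ‖ + ‖v‖) * ‖y - s‖ := by
    refine (neg_le_abs _).trans ((abs_real_inner_le_norm _ _).trans ?_)
    gcongr
    exact norm_add₃_le
  rw [inner_add_left _ v] at h4
  refine le_of_mul_le_mul_right ?_ h0
  nlinarith

/-- Polarization: for `y` of length `‖x‖` in the direction of `Q x`, `4 ‖x‖ ‖Q x‖ = 4 ⟨Q x, y⟩` is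
the form at `x + y` minus the form at `x - y`, hence at most `M ‖x + y‖² ≤ 4 M ‖x‖²`. -/
theorem norm_apply_le_of_isPositive {M : ℝ} (hQ : Q.IsPositive)
    (hM : ∀ h, inner ℝ h (Q h) ≤ M * ‖h‖ ^ 2) (x : Vec n) : ‖Q x‖ ≤ M * ‖x‖ := by
  have hsym : ∀ a b, inner ℝ (Q a) b = inner ℝ a (Q b) := fun a b => hQ.isSymmetric a b
  have hpos : ∀ a, 0 ≤ inner ℝ a (Q a) := fun a => hQ.inner_nonneg_right a
  rcases eq_or_ne (Q x) 0 with h0 | h0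
  · rcases eq_or_ne x 0 with rfl | hx
    · simp
    · rw [h0, norm_zero]
      have := (hpos x).trans (hM x)
      have hx : 0 < ‖x‖ := norm_pos_iff.2 hx
      nlinarith [nonneg_of_mul_nonneg_left this (by positivity)]
  have hx : 0 < ‖x‖ := norm_pos_iff.2 fun h => h0 (by rw [h, map_zero])
  have hq : 0 < ‖Q x‖ := norm_pos_iff.2 h0
  set y : Vec n := (‖x‖ / ‖Q x‖) • Q x with hy
  have hyn : ‖y‖ = ‖x‖ := by
    rw [hy, norm_smul, Real.norm_of_nonneg (by positivity), div_mul_cancel₀ _ hq.ne']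
  have hxy : inner ℝ (Q x) y = ‖x‖ * ‖Q x‖ := by
    rw [hy, real_inner_smul_right, real_inner_self_eq_norm_sq]
    field_simp
  have e1 := hM (x + y)
  have e2 := hpos (x - y)
  rw [map_add, inner_add_right, inner_add_left, inner_add_left, ← hsym x y,
    real_inner_comm (Q x) y] at e1
  rw [map_sub, inner_sub_right, inner_sub_left, inner_sub_left, ← hsym x y,
    real_inner_comm (Q x) y] at e2
  have e3 : ‖x + y‖ ^ 2 ≤ 4 * ‖x‖ ^ 2 := by
    have := norm_add_le x y
    rw [hyn] at this
    nlinarith [norm_nonneg (x + y)]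
  have hM0 : 0 ≤ M := by
    have := (hpos x).trans (hM x)
    exact nonneg_of_mul_nonneg_left this (by positivity)
  have e4 := mul_le_mul_of_nonneg_left e3 hM0
  refine le_of_mul_le_mul_right ?_ hx
  nlinarith

end Subproblem

/-! ### Consequences of the basic assumption -/

section Basic

variable {n m : ℕ} {f : Vec n → EReal} {φ ψ : Vec n → ℝ} {g : Vec n → Vec m}

theorem continuous_of_convexOn_univ {φ : Vec n → ℝ} (h : ConvexOn ℝ Set.univ φ) : Continuous φ :=
  continuousOn_univ.1 (h.continuousOn isOpen_univ)

theorem BasicAssumption.isClosed_feasibleSet (h : BasicAssumption f φ ψ g) :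
    IsClosed (feasibleSet g) :=
  isClosed_nonposOrthant.preimage h.g_diff.continuous

/-- The real value of `f + φ - ψ`. -/
noncomputable def realObjective (f : Vec n → EReal) (φ ψ : Vec n → ℝ) (x : Vec n) : ℝ :=
  (f x).toReal + (φ x - ψ x)

theorem BasicAssumption.coe_toReal (h : BasicAssumption f φ ψ g) {x : Vec n} (hx : f x ≠ ⊤) :
    ((f x).toReal : EReal) = f x :=
  EReal.coe_toReal hx (h.f_ne_bot x)

theorem BasicAssumption.objective_eq (h : BasicAssumption f φ ψ g) {x : Vec n}
    (hx : x ∈ feasibleSet g) : objective f φ ψ g x = realObjective f φ ψ x := by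
  obtain ⟨O, -, -, hO, hf, -⟩ := h.f_smooth
  rw [objective, indicatorFn_of_mem hx, add_zero, ← h.coe_toReal (hf x (hO hx)), ← EReal.coe_add,
    realObjective]

theorem hasFDerivAt_toReal {O : Set (Vec n)} (hO : IsOpen O)
    (hd : DifferentiableOn ℝ (fun z => (f z).toReal) O) {x : Vec n} (hx : x ∈ O) :
    HasFDerivAt (fun z => (f z).toReal) (innerSL ℝ (grad f x)) x := by
  have := (hd.differentiableAt (hO.mem_nhds hx)).hasGradientAt
  exact this.hasFDerivAt

theorem exists_quadratic_bound_toReal {O K : Set (Vec n)} (hO : IsOpen O)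
    (hd : DifferentiableOn ℝ (fun z => (f z).toReal) O) (hL : LocallyLipschitzOn O (grad f))
    (hK : IsCompact K) (hKO : K ⊆ O) :
    ∃ C, 0 ≤ C ∧ ∀ x ∈ K, ∀ x' ∈ K,
      |(f x').toReal - (f x).toReal - inner ℝ (grad f x) (x' - x)| ≤ C * ‖x' - x‖ ^ 2 ∧
        ‖grad f x' - grad f x‖ ≤ C * ‖x' - x‖ := by
  have hL' : LocallyLipschitzOn O fun x => innerSL ℝ (grad f x) := by
    intro x hx
    obtain ⟨B, t, ht, h⟩ := hL hx
    refine ⟨B, t, ht, LipschitzOnWith.of_dist_le_mul fun a ha b hb => ?_⟩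
    rw [dist_eq_norm, ← map_sub, innerSL_apply_norm, ← dist_eq_norm]
    exact h.dist_le_mul a ha b hb
  obtain ⟨C, hC, h⟩ := exists_quadratic_bound hO (fun x hx => hasFDerivAt_toReal hO hd hx) hL' hK hKO
  refine ⟨C, hC, fun x hx x' hx' => ?_⟩
  have := h x hx x' hx'
  rwa [← map_sub, innerSL_apply_norm, innerSL_apply_apply, Real.norm_eq_abs] at this

theorem exists_quadratic_bound_closedBall (hg : Differentiable ℝ g)
    (hL : LocallyLipschitz (fderiv ℝ g)) (R : ℝ) :
    ∃ C, 0 ≤ C ∧ ∀ x, ‖x‖ ≤ R → ∀ x', ‖x'‖ ≤ R →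
      ‖g x' - g x - fderiv ℝ g x (x' - x)‖ ≤ C * ‖x' - x‖ ^ 2 ∧
        ‖fderiv ℝ g x' - fderiv ℝ g x‖ ≤ C * ‖x' - x‖ := by
  obtain ⟨C, hC, h⟩ := exists_quadratic_bound isOpen_univ (fun x _ => (hg x).hasFDerivAt)
    (locallyLipschitzOn_univ.2 hL) (isCompact_closedBall (0 : Vec n) R) (Set.subset_univ _)
  exact ⟨C, hC, fun x hx x' hx' => h x (by simpa using hx) x' (by simpa using hx')⟩

end Basic

/-! ### Elementary properties of a run -/

section Run

variable {n m : ℕ} {f : Vec n → EReal} {φ ψ : Vec n → ℝ} {g : Vec n → Vec m} {p : Params}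
  {r : Run n m}

theorem IsRun.mem_feasibleSet (h : IsRun f φ ψ g p r) (k : ℕ) : r.x k ∈ feasibleSet g := by
  cases k with
  | zero => exact h.init
  | succ k => rw [h.next]; exact (h.accepted k).1

theorem IsRun.muMin_le (h : IsRun f φ ψ g p r) (k : ℕ) :
    ∀ j ≤ r.jlast k, p.muMin ≤ r.mu k j := by
  intro j
  induction j with
  | zero => exact fun _ => (h.mu_init k).1
  | succ j ih =>
    intro hj
    have ih := ih (by omega)
    by_cases hy : r.y k j ∈ feasibleSet g
    · rw [(h.update_mu k j (by omega) hy).2]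
      nlinarith [p.muMin_pos, p.one_lt_tau]
    · rwa [(h.update_L k j (by omega) hy).2]

theorem IsRun.LMin_le (h : IsRun f φ ψ g p r) (k : ℕ) :
    ∀ j ≤ r.jlast k, ∀ i, p.LMin ≤ r.L k j i := by
  intro j
  induction j with
  | zero => exact fun _ i => (h.L_init k i).1
  | succ j ih =>
    intro hj i
    have ih := ih (by omega) i
    by_cases hy : r.y k j ∈ feasibleSet g
    · rwa [(h.update_mu k j (by omega) hy).1]
    · rw [(h.update_L k j (by omega) hy).1, PiLp.smul_apply, smul_eq_mul]
      nlinarith [p.LMin_pos, p.one_lt_tau]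

theorem IsRun.L_nonneg (h : IsRun f φ ψ g p r) {k j : ℕ} (hj : j ≤ r.jlast k) (i : Fin m) :
    0 ≤ r.L k j i :=
  p.LMin_pos.le.trans (h.LMin_le k j hj i)

theorem IsRun.mu_mul_le (h : IsRun f φ ψ g p r) {k j : ℕ} (hj : j ≤ r.jlast k) (z : Vec n) :
    r.mu k j * ‖z‖ ^ 2 ≤ inner ℝ z (r.Q k j z) := by
  have := (h.Q_lower k j hj).inner_nonneg_right z
  simp only [sub_apply, smul_apply, ContinuousLinearMap.id_apply, inner_sub_right,
    inner_smul_right, real_inner_self_eq_norm_sq] at this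
  linarith

theorem IsRun.inner_Q_le (h : IsRun f φ ψ g p r) {k j : ℕ} (hj : j ≤ r.jlast k) (z : Vec n) :
    inner ℝ z (r.Q k j z) ≤ (r.mu k j + p.M) * ‖z‖ ^ 2 := by
  have := (h.Q_upper k j hj).inner_nonneg_right z
  simp only [sub_apply, smul_apply, ContinuousLinearMap.id_apply, inner_sub_right,
    inner_smul_right, real_inner_self_eq_norm_sq] at this
  linarith

theorem IsRun.isPositive_Q (h : IsRun f φ ψ g p r) {k j : ℕ} (hj : j ≤ r.jlast k) :
    (r.Q k j).IsPositive := by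
  have h1 : (r.mu k j • ContinuousLinearMap.id ℝ (Vec n)).IsPositive :=
    ContinuousLinearMap.isPositive_id.smul_of_nonneg (p.muMin_pos.le.trans (h.muMin_le k j hj))
  have := (h.Q_lower k j hj).add h1
  rwa [sub_add_cancel] at this

theorem ballMap_self (g : Vec n → Vec m) (s : Vec n) (L : Vec m) : ballMap g s s L = g s := by
  simp [ballMap]

theorem IsRun.subObj_xbar_le (h : IsRun f φ ψ g p r) {k j : ℕ} (hj : j ≤ r.jlast k) :
    subObj f φ ψ (r.x k) (r.xi k) (r.Q k j) (r.xbar k j)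
      ≤ subObj f φ ψ (r.x k) (r.xi k) (r.Q k j) (r.x k) := by
  refine h.xbar_min k j hj ?_
  change ballMap g (r.x k) (r.x k) (r.L k j) ∈ nonposOrthant m
  rw [ballMap_self]
  exact h.mem_feasibleSet k

/-- The last term of the residual bounds the violation of the constraints. -/
theorem IsRun.norm_posPart_le (h : IsRun f φ ψ g p r) {k j : ℕ} (hj : j ≤ r.jlast k) :
    ‖(fun i => max (ballMap g (r.y k j) (r.x k) (r.L k j) i) 0 : Fin m → ℝ)‖
      ≤ p.betaR / 2 * ‖r.y k j - r.x k‖ ^ 2 := by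
  refine le_trans ?_ (h.residual_le k j hj)
  unfold kktResidual
  have h1 := le_max_right (inner ℝ (r.y k j) (dualResidual f ψ g (r.x k) (r.xi k) (r.Q k j)
    (r.L k j) (r.y k j) (r.v k j) (r.mult k j))) 0
  have h2 := le_max_right (-inner ℝ (r.mult k j) (ballMap g (r.y k j) (r.x k) (r.L k j))) 0
  have h3 := norm_nonneg (dualResidual f ψ g (r.x k) (r.xi k) (r.Q k j) (r.L k j) (r.y k j)
    (r.v k j) (r.mult k j))
  linarith

theorem IsRun.isSubgrad_xi (hp : BasicAssumption f φ ψ g) (h : IsRun f φ ψ g p r) (k : ℕ) :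
    IsSubgrad ψ (r.x k) (-r.xi k) :=
  isSubgrad_neg_of_mem_limSubdiff_neg hp.psi_convex
    (continuous_of_convexOn_univ hp.psi_convex) (h.xi_mem k)

theorem IsRun.descent_realObjective (hp : BasicAssumption f φ ψ g) (h : IsRun f φ ψ g p r)
    (k : ℕ) : p.alpha / 2 * ‖r.x (k + 1) - r.x k‖ ^ 2
      ≤ realObjective f φ ψ (r.x k) - realObjective f φ ψ (r.x (k + 1)) := by
  have h1 := (h.accepted k).2
  rw [← h.next, hp.objective_eq (h.mem_feasibleSet k), hp.objective_eq (h.mem_feasibleSet (k + 1)),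
    ← EReal.coe_sub, EReal.coe_le_coe_iff] at h1
  linarith

theorem IsRun.antitone_realObjective (hp : BasicAssumption f φ ψ g) (h : IsRun f φ ψ g p r) :
    Antitone fun k => realObjective f φ ψ (r.x k) :=
  antitone_nat_of_succ_le fun k => by
    have h1 := h.descent_realObjective hp k
    have : 0 ≤ p.alpha / 2 * ‖r.x (k + 1) - r.x k‖ ^ 2 := by
      have := p.alpha_pos
      positivity
    linarith

theorem IsRun.exists_tendsto_realObjective (hp : BasicAssumption f φ ψ g)
    (h : IsRun f φ ψ g p r) :
    ∃ F, Tendsto (fun k => realObjective f φ ψ (r.x k)) atTop (𝓝 F) ∧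
      ∀ k, F ≤ realObjective f φ ψ (r.x k) := by
  obtain ⟨b, hb⟩ := hp.bddBelow
  have hbdd : BddBelow (Set.range fun k => realObjective f φ ψ (r.x k)) := by
    refine ⟨b, ?_⟩
    rintro _ ⟨k, rfl⟩
    have := hb _ (h.mem_feasibleSet k)
    rwa [hp.objective_eq (h.mem_feasibleSet k), EReal.coe_le_coe_iff] at this
  exact ⟨_, tendsto_atTop_ciInf (h.antitone_realObjective hp) hbdd, fun k => ciInf_le hbdd k⟩

theorem IsRun.tendsto_norm_step (hp : BasicAssumption f φ ψ g) (h : IsRun f φ ψ g p r) :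
    Tendsto (fun k => ‖r.x (k + 1) - r.x k‖) atTop (𝓝 0) := by
  obtain ⟨F, hF, -⟩ := h.exists_tendsto_realObjective hp
  have h1 : Tendsto (fun k => 2 / p.alpha * (realObjective f φ ψ (r.x k)
      - realObjective f φ ψ (r.x (k + 1)))) atTop (𝓝 0) := by
    have := (hF.sub (hF.comp (tendsto_add_atTop_nat 1))).const_mul (2 / p.alpha)
    rwa [sub_self, mul_zero] at this
  have h2 : Tendsto (fun k => ‖r.x (k + 1) - r.x k‖ ^ 2) atTop (𝓝 0) := by
    refine squeeze_zero (fun k => by positivity) (fun k => ?_) h1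
    have := h.descent_realObjective hp k
    have ha := p.alpha_pos
    calc ‖r.x (k + 1) - r.x k‖ ^ 2
        = 2 / p.alpha * (p.alpha / 2 * ‖r.x (k + 1) - r.x k‖ ^ 2) := by field_simp
      _ ≤ _ := by gcongr
  have := h2.sqrt
  simpa using this

/-- Uniform bounds for the quantities of a run with bounded iterates. -/
theorem IsRun.exists_bound (hp : BasicAssumption f φ ψ g) (h : IsRun f φ ψ g p r)
    (hbdd : Bornology.IsBounded (Set.range r.x)) :
    ∃ R, 0 < R ∧ (∀ k, ‖r.x k‖ ≤ R ∧ ‖grad f (r.x k)‖ ≤ R ∧ ‖r.xi k‖ ≤ R) ∧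
      ∀ k, ∀ j ≤ r.jlast k, ‖r.y k j‖ ≤ R ∧ ‖r.xbar k j‖ ≤ R := by
  obtain ⟨R₀, hR₀⟩ := hbdd.exists_norm_le
  have hx : ∀ k, ‖r.x k‖ ≤ R₀ := fun k => hR₀ _ ⟨k, rfl⟩
  have hφc := continuous_of_convexOn_univ hp.phi_convex
  obtain ⟨B₁, hB₁, hφ⟩ := exists_norm_isSubgrad_le hφc R₀
  obtain ⟨B₂, hB₂, hψ⟩ :=
    exists_norm_isSubgrad_le (continuous_of_convexOn_univ hp.psi_convex) R₀
  obtain ⟨O, hO, -, hΓ, -, -, hlip⟩ := hp.f_smooth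
  obtain ⟨B₃, hB₃⟩ := ((isCompact_closedBall (0 : Vec n) R₀).inter_right
    hp.isClosed_feasibleSet).exists_bound_of_continuousOn
      (hlip.continuousOn.mono (Set.inter_subset_right.trans hΓ))
  have hgrad : ∀ k, ‖grad f (r.x k)‖ ≤ B₃ := fun k =>
    hB₃ _ ⟨by simpa using hx k, h.mem_feasibleSet k⟩
  have hxi : ∀ k, ‖r.xi k‖ ≤ B₂ := fun k => by
    rw [← norm_neg]
    exact hψ _ _ (hx k) (h.isSubgrad_xi hp k)
  -- Applies to both the inexact and the exact solution, since neither exceeds the model value at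
  -- `x^k`; the strong convexity modulus is at least `muMin`.
  have hnear : ∀ k, ∀ j ≤ r.jlast k, ∀ y, subObj f φ ψ (r.x k) (r.xi k) (r.Q k j) y
      ≤ subObj f φ ψ (r.x k) (r.xi k) (r.Q k j) (r.x k) →
      ‖y‖ ≤ 2 * (B₃ + B₂ + B₁) / p.muMin + R₀ := by
    intro k j hj y hy
    obtain ⟨v, hv⟩ := exists_isSubgrad hp.phi_convex hφc (r.x k)
    have h1 := mul_norm_sub_le_of_subObj_le (h.isPositive_Q hj).isSymmetric (h.mu_mul_le hj) hv hy
    have h2 := h.muMin_le k j hj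
    have h3 : p.muMin / 2 * ‖y - r.x k‖ ≤ B₃ + B₂ + B₁ := by
      calc p.muMin / 2 * ‖y - r.x k‖ ≤ r.mu k j / 2 * ‖y - r.x k‖ := by gcongr
        _ ≤ _ := h1
        _ ≤ _ := by
          gcongr
          exacts [hgrad k, hxi k, hφ _ _ (hx k) hv]
    have h4 : ‖y - r.x k‖ ≤ 2 * (B₃ + B₂ + B₁) / p.muMin := by
      rw [le_div_iff₀ p.muMin_pos]
      linarith
    calc ‖y‖ = ‖(y - r.x k) + r.x k‖ := by rw [sub_add_cancel]
      _ ≤ ‖y - r.x k‖ + ‖r.x k‖ := norm_add_le _ _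
      _ ≤ _ := add_le_add h4 (hx k)
  have hR0 : 0 ≤ R₀ := (norm_nonneg _).trans (hx 0)
  have hB3 : 0 ≤ B₃ := (norm_nonneg _).trans (hgrad 0)
  have hE : 0 ≤ 2 * (B₃ + B₂ + B₁) / p.muMin := by have := p.muMin_pos; positivity
  refine ⟨2 * (B₃ + B₂ + B₁) / p.muMin + R₀ + B₃ + B₂ + 1, by positivity, fun k => ⟨?_, ?_, ?_⟩,
    fun k j hj => ⟨?_, ?_⟩⟩
  · linarith [hx k]
  · linarith [hgrad k]
  · linarith [hxi k]
  · linarith [hnear k j hj _ (h.descent k j hj)]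
  · linarith [hnear k j hj _ (h.subObj_xbar_le hj)]

/-- The parameters `L` of a run with bounded iterates are bounded. -/
theorem IsRun.exists_L_le (hp : BasicAssumption f φ ψ g) (h : IsRun f φ ψ g p r)
    (hbdd : Bornology.IsBounded (Set.range r.x)) :
    ∃ B, ∀ k, ∀ j ≤ r.jlast k, ∀ i, r.L k j i ≤ B := by
  obtain ⟨R, hR, hx, hy⟩ := h.exists_bound hp hbdd
  obtain ⟨C, hC, hquad⟩ := exists_quadratic_bound_closedBall hp.g_diff hp.g_lip R
  -- In a violated component `i`, `g_i(y)` exceeds its linearization by at most `C ‖y - x‖²`, while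
  -- the residual bounds the model by `(betaR / 2) ‖y - x‖²`. If `L_i / 2 ≥ C + betaR / 2`, these
  -- give `g_i(y) ≤ 0`.
  have hfail : ∀ k, ∀ j ≤ r.jlast k, r.y k j ∉ feasibleSet g →
      ∃ i, r.L k j i < 2 * C + p.betaR := by
    intro k j hj hyn
    have : ∃ i, 0 < g (r.y k j) i := by
      by_contra hcon
      push Not at hcon
      exact hyn hcon
    obtain ⟨i, hi⟩ := this
    refine ⟨i, ?_⟩
    by_contra hL
    have h1 := (PiLp.norm_apply_le (g (r.y k j) - g (r.x k)
      - fderiv ℝ g (r.x k) (r.y k j - r.x k)) i).trans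
      (hquad _ (hx k).1 _ (hy k j hj).1).1
    have h2 := (le_max_left _ _).trans ((le_abs_self _).trans ((norm_le_pi_norm
      (fun i => max (ballMap g (r.y k j) (r.x k) (r.L k j) i) 0 : Fin m → ℝ) i).trans
      (h.norm_posPart_le hj)))
    simp only [ballMap, PiLp.add_apply, PiLp.smul_apply, smul_eq_mul] at h2
    rw [Real.norm_eq_abs] at h1
    have h3 := (le_abs_self _).trans h1
    simp only [PiLp.sub_apply] at h3
    have : (2 * C + p.betaR) * ‖r.y k j - r.x k‖ ^ 2 ≤ r.L k j i * ‖r.y k j - r.x k‖ ^ 2 :=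
      mul_le_mul_of_nonneg_right (not_lt.1 hL) (by positivity)
    linarith
  have hτ := p.one_lt_tau
  have hL0 := p.LMin_pos
  set T : ℝ := max 1 (p.tau * ((2 * C + p.betaR) / p.LMin)) with hT
  -- A failure bounds only one component, but all components share the growth factor `t`. Since `t *
  -- LMin` is below the threshold before an increase, `t` never exceeds `τ` times the threshold over
  -- `LMin`.
  have key : ∀ k, ∀ j ≤ r.jlast k, ∃ t : ℝ, 1 ≤ t ∧ t ≤ T ∧ r.L k j = t • r.L k 0 := by
    intro k j
    induction j with
    | zero => exact fun _ => ⟨1, le_rfl, le_max_left _ _, (one_smul ℝ _).symm⟩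
    | succ j ih =>
      intro hj
      obtain ⟨t, ht1, htT, ht⟩ := ih (by omega)
      by_cases hyn : r.y k j ∈ feasibleSet g
      · exact ⟨t, ht1, htT, by rw [(h.update_mu k j (by omega) hyn).1, ht]⟩
      · obtain ⟨i, hi⟩ := hfail k j (by omega) hyn
        refine ⟨p.tau * t, by nlinarith, le_max_of_le_right ?_, ?_⟩
        · refine mul_le_mul_of_nonneg_left ?_ (by linarith)
          rw [le_div_iff₀ hL0]
          rw [ht, PiLp.smul_apply, smul_eq_mul] at hi
          have := mul_le_mul_of_nonneg_left (h.L_init k i).1 (by linarith : 0 ≤ t)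
          linarith
        · rw [(h.update_L k j (by omega) hyn).1, ht, smul_smul]
  refine ⟨T * p.LMax, fun k j hj i => ?_⟩
  obtain ⟨t, ht1, htT, ht⟩ := key k j hj
  rw [ht, PiLp.smul_apply, smul_eq_mul]
  have h1 := (h.L_init k i).1
  exact mul_le_mul htT (h.L_init k i).2 (by linarith) (by linarith)

/-- The parameters `μ` of a run with bounded iterates are bounded. -/
theorem IsRun.exists_mu_le (hp : BasicAssumption f φ ψ g) (h : IsRun f φ ψ g p r)
    (hbdd : Bornology.IsBounded (Set.range r.x)) :
    ∃ B, ∀ k, ∀ j ≤ r.jlast k, r.mu k j ≤ B := by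
  obtain ⟨R, hR, hx, hy⟩ := h.exists_bound hp hbdd
  obtain ⟨O, hO, -, hΓ, -, hd, hlip⟩ := hp.f_smooth
  obtain ⟨C, hC, hquad⟩ := exists_quadratic_bound_toReal hO hd hlip
    ((isCompact_closedBall (0 : Vec n) R).inter_right hp.isClosed_feasibleSet)
    (Set.inter_subset_right.trans hΓ)
  have hτ := p.one_lt_tau
  -- If `μ > 2 C + α`, the model's quadratic term dominates the error `C ‖y - x‖²` of linearizing
  -- `f` and still leaves `(α / 2) ‖y - x‖²`. As `ξ` gives a majorant of `-ψ`, the test would then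
  -- accept `y`.
  have hfail : ∀ k, ∀ j < r.jlast k, r.y k j ∈ feasibleSet g →
      r.mu k j ≤ 2 * C + p.alpha := by
    intro k j hj hyn
    by_contra hmu
    refine h.continues k j hj ⟨hyn, ?_⟩
    rw [hp.objective_eq hyn, hp.objective_eq (h.mem_feasibleSet k), ← EReal.coe_sub,
      EReal.coe_le_coe_iff]
    have h1 := (hquad _ ⟨by simpa using (hx k).1, h.mem_feasibleSet k⟩ _
      ⟨by simpa using (hy k j hj.le).1, hyn⟩).1
    have h2 := h.isSubgrad_xi hp k (r.y k j)
    have h3 := h.descent k j hj.le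
    have h4 := subObj_sub (f := f) (φ := φ) (ψ := ψ) (s := r.x k) (ξ := r.xi k) (x := r.x k)
      (h.isPositive_Q hj.le).isSymmetric (r.y k j)
    rw [sub_self, map_zero, add_zero, inner_add_left] at h4
    rw [inner_neg_left] at h2
    have h5 := h.mu_mul_le hj.le (r.y k j - r.x k)
    have h6 := (le_abs_self _).trans h1
    have : (2 * C + p.alpha) * ‖r.y k j - r.x k‖ ^ 2 ≤ r.mu k j * ‖r.y k j - r.x k‖ ^ 2 :=
      mul_le_mul_of_nonneg_right (not_le.1 hmu).le (by positivity)
    unfold realObjective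
    linarith
  refine ⟨max p.muMax (p.tau * (2 * C + p.alpha)), fun k j => ?_⟩
  induction j with
  | zero => exact fun _ => le_max_of_le_left (h.mu_init k).2
  | succ j ih =>
    intro hj
    by_cases hyn : r.y k j ∈ feasibleSet g
    · rw [(h.update_mu k j (by omega) hyn).2]
      exact le_max_of_le_right (mul_le_mul_of_nonneg_left (hfail k j (by omega) hyn) (by linarith))
    · rw [(h.update_L k j (by omega) hyn).2]
      exact ih (by omega)

end Run

/-! ### Bounded multipliers for the exact solutions of the subproblems -/

section Multipliers

variable {n m : ℕ} {f : Vec n → EReal} {φ ψ : Vec n → ℝ} {g : Vec n → Vec m} {p : Params}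
  {r : Run n m}

/-- The optimality conditions at the exact solution of the last subproblem of an outer iteration,
with a bounded subgradient `v` of `φ` and a bounded multiplier `l`. -/
structure IsBoundedKKT (f : Vec n → EReal) (φ : Vec n → ℝ) (g : Vec n → Vec m) (r : Run n m)
    (C : ℝ) (k : ℕ) (v : Vec n) (l : Vec m) : Prop where
  subgrad : IsSubgrad φ (r.xbar k (r.jlast k)) v
  nonneg : ∀ i, 0 ≤ l i
  compl : inner ℝ l (ballMap g (r.xbar k (r.jlast k)) (r.x k) (r.L k (r.jlast k))) = 0
  kkt : jacT (fun z => ballMap g z (r.x k) (r.L k (r.jlast k))) (r.xbar k (r.jlast k)) l =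
    -(grad f (r.x k) + r.xi k + r.Q k (r.jlast k) (r.xbar k (r.jlast k) - r.x k) + v)
  norm_v : ‖v‖ ≤ C
  norm_l : ‖l‖ ≤ C
  norm_sub : ‖r.xbar k (r.jlast k) - r.x k‖ ≤ C * ‖r.x (k + 1) - r.x k‖

theorem norm_le_of_forall_le {L : Vec m} {B : ℝ} (h0 : ∀ i, 0 ≤ L i) (hB : 0 ≤ B)
    (h : ∀ i, L i ≤ B) : ‖L‖ ≤ m * B := by
  rcases eq_or_ne L 0 with rfl | hL
  · simp; positivity
  have hn : 0 < ‖L‖ := norm_pos_iff.2 hL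
  have h1 : inner ℝ L L ≤ m * ‖L‖ * B := (inner_le_mul_norm_posPart h0).trans
    (mul_le_mul_of_nonneg_left ((pi_norm_le_iff_of_nonneg hB).2 fun i => by
      rw [Real.norm_of_nonneg (le_max_right _ _)]
      exact max_le (h i) hB) (by positivity))
  rw [real_inner_self_eq_norm_sq] at h1
  refine le_of_mul_le_mul_right ?_ hn
  linarith

theorem tendsto_clm_apply {E F ι : Type*} [NormedAddCommGroup E] [NormedSpace ℝ E]
    [NormedAddCommGroup F] [NormedSpace ℝ F] {l : Filter ι} {A : ι → E →L[ℝ] F} {z : ι → E}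
    {A₀ : E →L[ℝ] F} {z₀ : E} (hA : Tendsto A l (𝓝 A₀)) (hz : Tendsto z l (𝓝 z₀)) :
    Tendsto (fun i => A i (z i)) l (𝓝 (A₀ z₀)) :=
  ((isBoundedBilinearMap_apply (𝕜 := ℝ)).continuous.tendsto (A₀, z₀)).comp (hA.prodMk_nhds hz)

theorem IsRun.exists_parameter_bound (hp : BasicAssumption f φ ψ g) (h : IsRun f φ ψ g p r)
    (hbdd : Bornology.IsBounded (Set.range r.x)) :
    ∃ B, 0 < B ∧ ∀ k, ‖r.L k (r.jlast k)‖ ≤ B ∧ ‖r.Q k (r.jlast k)‖ ≤ B := by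
  obtain ⟨B₁, h₁⟩ := h.exists_L_le hp hbdd
  obtain ⟨B₂, h₂⟩ := h.exists_mu_le hp hbdd
  have hM := p.M_pos
  refine ⟨m * max B₁ 0 + (max B₂ 0 + p.M), by positivity, fun k => ⟨?_, ?_⟩⟩
  · refine (norm_le_of_forall_le (h.L_nonneg le_rfl) (le_max_right B₁ 0) fun i =>
      (h₁ k _ le_rfl i).trans (le_max_left _ _)).trans (le_add_of_nonneg_right (by positivity))
  · refine ContinuousLinearMap.opNorm_le_bound _ (by positivity) fun z => ?_
    refine (norm_apply_le_of_isPositive (h.isPositive_Q le_rfl) (h.inner_Q_le le_rfl) z).trans ?_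
    refine mul_le_mul_of_nonneg_right ?_ (norm_nonneg z)
    have : r.mu k (r.jlast k) ≤ max B₂ 0 := (h₂ k _ le_rfl).trans (le_max_left _ _)
    have : (0 : ℝ) ≤ m * max B₁ 0 := by positivity
    linarith

/-- Under the partial bounded multiplier property the exact solutions of the subproblems
eventually have bounded multipliers. -/
theorem IsRun.exists_multiplier_bound (hp : BasicAssumption f φ ψ g) (h : IsRun f φ ψ g p r)
    (hbdd : Bornology.IsBounded (Set.range r.x))
    (hBMP : ∀ q ∈ clusterSet (paramSeq r),
      PartialBMP (paramSet n m) (paramConstraint g) q.1 q.2) :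
    ∃ κ : ℝ, 0 ≤ κ ∧ ∀ᶠ k in atTop,
      ∀ y ∈ normalCone (subFeasible g (r.x k) (r.L k (r.jlast k))) (r.xbar k (r.jlast k)),
      ∃ l ∈ normalCone (nonposOrthant m)
          (ballMap g (r.xbar k (r.jlast k)) (r.x k) (r.L k (r.jlast k))),
        jacT (fun z => ballMap g z (r.x k) (r.L k (r.jlast k))) (r.xbar k (r.jlast k)) l = y ∧
          ‖l‖ ≤ κ * ‖y‖ := by
  obtain ⟨R, hR, hx, hy⟩ := h.exists_bound hp hbdd
  obtain ⟨B, hB, hLQ⟩ := h.exists_parameter_bound hp hbdd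
  have : ProperSpace (Vec n →L[ℝ] Vec n) := FiniteDimensional.proper ℝ _
  have hmem : ∀ k, paramSeq r k ∈
      Metric.closedBall (0 : ParamSpace n m × Vec n) (max R B) := by
    intro k
    rw [Metric.mem_closedBall, dist_zero_right]
    simp only [paramSeq, Prod.norm_def]
    refine max_le (max_le ?_ (max_le ?_ (max_le ?_ ?_))) ?_
    · exact (hLQ k).1.trans (le_max_right _ _)
    · exact (hLQ k).2.trans (le_max_right _ _)
    · exact (hx k).2.2.trans (le_max_left _ _)
    · exact (hx k).1.trans (le_max_left _ _)
    · exact (hy k _ le_rfl).2.trans (le_max_left _ _)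
  choose! κ hκ A hA V hV hmult using fun q hq => (hBMP q hq).2.2
  obtain ⟨T, hT, hcov⟩ := exists_finset_cover_clusterSet (isCompact_closedBall _ _)
    (Eventually.of_forall hmem) (V := fun q => A q ×ˢ V q)
    (fun q hq => prod_mem_nhds (hA q hq) (hV q hq))
  -- The sum dominates each of the finitely many local constants.
  refine ⟨∑ q ∈ T, κ q, Finset.sum_nonneg fun q hq => (hκ q (hT q hq)).le, ?_⟩
  filter_upwards [hcov] with k hk y hyN
  obtain ⟨q, hq, hqA, hqV⟩ := hk
  have hU : (paramSeq r k).1 ∈ paramSet n m := by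
    refine ⟨h.L_nonneg le_rfl, h.isPositive_Q le_rfl, fun z hz => ?_⟩
    have h1 := h.mu_mul_le (le_refl (r.jlast k)) z
    have h2 := h.muMin_le k _ le_rfl
    have h3 := p.muMin_pos
    have : 0 < ‖z‖ := norm_pos_iff.2 hz
    have : 0 < r.mu k (r.jlast k) * ‖z‖ ^ 2 := mul_pos (by linarith) (by positivity)
    exact this.trans_le h1
  obtain ⟨l, ⟨hl, hly⟩, hlκ⟩ := hmult q (hT q hq) _ ⟨hqA, hU⟩ _
    ⟨hqV, h.xbar_mem k _ le_rfl⟩ y hyN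
  refine ⟨l, hl, hly, hlκ.trans (mul_le_mul_of_nonneg_right ?_ (norm_nonneg _))⟩
  exact Finset.single_le_sum (f := κ) (fun q hq => (hκ q (hT q hq)).le) hq

/-- The normal vector in the optimality condition consists of bounded terms, so its multiplier is
bounded. Strong convexity of the Lagrangian, tested at `x^{k+1}`, then controls the distance to the
exact solution by the two inexactness criteria. -/
theorem IsRun.exists_isBoundedKKT (hp : BasicAssumption f φ ψ g) (h : IsRun f φ ψ g p r)
    (hbdd : Bornology.IsBounded (Set.range r.x))
    (hBMP : ∀ q ∈ clusterSet (paramSeq r),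
      PartialBMP (paramSet n m) (paramConstraint g) q.1 q.2) :
    ∃ C, 0 < C ∧ ∃ (v : ℕ → Vec n) (l : ℕ → Vec m),
      ∀ᶠ k in atTop, IsBoundedKKT f φ g r C k (v k) (l k) := by
  obtain ⟨R, hR, hx, hy⟩ := h.exists_bound hp hbdd
  obtain ⟨B, hB, hLQ⟩ := h.exists_parameter_bound hp hbdd
  obtain ⟨κ, hκ, hmult⟩ := h.exists_multiplier_bound hp hbdd hBMP
  have hφc := continuous_of_convexOn_univ hp.phi_convex
  obtain ⟨D, hD, hφ⟩ := exists_norm_isSubgrad_le hφc R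
  set N : ℝ := κ * (R + R + B * (R + R) + D) with hN
  have hN0 : 0 ≤ N := by positivity
  have hμ := p.muMin_pos
  have hβR := p.betaR_pos
  have hβF := p.betaF_pos
  -- From `(muMin / 2) ‖x^{k+1} - xbar‖² ≤ (betaF / 2) d² + m N (betaR / 2) d²`: the gap, plus the
  -- violation weighted by the multiplier bound `N`.
  set S : ℝ := (p.betaF + m * N * p.betaR) / p.muMin with hS
  have hS0 : 0 ≤ S := by positivity
  suffices hk : ∀ᶠ k in atTop, ∃ (v : Vec n) (l : Vec m),
      IsBoundedKKT f φ g r (D + N + √S + 1) k v l by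
    obtain ⟨K, hK⟩ := eventually_atTop.1 hk
    choose! v l hvl using hK
    exact ⟨D + N + √S + 1, by positivity, v, l, eventually_atTop.2 ⟨K, hvl⟩⟩
  filter_upwards [hmult] with k hk
  obtain ⟨v, hv, hvN⟩ := exists_subproblem_normal hp.phi_convex hφc
    (h.isPositive_Q le_rfl).isSymmetric (h.L_nonneg le_rfl) (h.xbar_mem k _ le_rfl)
    (h.xbar_min k _ le_rfl)
  obtain ⟨l, hl, hkkt, hlκ⟩ := hk _ hvN
  obtain ⟨-, hl0, hcomp⟩ := mem_normalCone_nonposOrthant_iff.1 hl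
  have hvD : ‖v‖ ≤ D := hφ _ _ (hy k _ le_rfl).2 hv
  have hlN : ‖l‖ ≤ N := by
    refine hlκ.trans (mul_le_mul_of_nonneg_left ?_ hκ)
    rw [norm_neg]
    refine norm_add₄_le.trans ?_
    gcongr
    · exact (hx k).2.1
    · exact (hx k).2.2
    · refine (ContinuousLinearMap.le_opNorm _ _).trans ?_
      gcongr
      · exact (hLQ k).2
      · refine (norm_sub_le _ _).trans (add_le_add (hy k _ le_rfl).2 (hx k).1)
  have hstrong := norm_sub_sq_le_of_kkt (ψ := ψ) (h.isPositive_Q le_rfl).isSymmetric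
    (h.mu_mul_le le_rfl) (h.L_nonneg le_rfl) hv hl0 hcomp hkkt (r.y k (r.jlast k))
  have hpen := (inner_le_mul_norm_posPart (y := ballMap g (r.y k (r.jlast k)) (r.x k)
    (r.L k (r.jlast k))) hl0).trans
    (mul_le_mul (mul_le_mul_of_nonneg_left hlN (Nat.cast_nonneg m)) (h.norm_posPart_le le_rfl)
      (norm_nonneg _) (by positivity))
  have hgap := h.gap_le k _ le_rfl
  rw [← h.next] at hstrong hpen hgap
  have hmu := h.muMin_le k _ le_rfl
  have hdist : ‖r.x (k + 1) - r.xbar k (r.jlast k)‖ ≤ √S * ‖r.x (k + 1) - r.x k‖ := by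
    refine le_of_sq_le_sq ?_ (by positivity)
    rw [mul_pow, Real.sq_sqrt hS0]
    have e1 : p.muMin / 2 * ‖r.x (k + 1) - r.xbar k (r.jlast k)‖ ^ 2 ≤
        r.mu k (r.jlast k) / 2 * ‖r.x (k + 1) - r.xbar k (r.jlast k)‖ ^ 2 := by gcongr
    have e2 : p.muMin * ‖r.x (k + 1) - r.xbar k (r.jlast k)‖ ^ 2 ≤
        p.muMin * (S * ‖r.x (k + 1) - r.x k‖ ^ 2) := by
      have : p.muMin * (S * ‖r.x (k + 1) - r.x k‖ ^ 2) =
          (p.betaF + m * N * p.betaR) * ‖r.x (k + 1) - r.x k‖ ^ 2 := by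
        rw [hS]; field_simp
      rw [this]
      linarith
    exact le_of_mul_le_mul_left e2 hμ
  have hsq := Real.sqrt_nonneg S
  refine ⟨v, l, hv, hl0, hcomp, hkkt, by linarith, by linarith, ?_⟩
  calc ‖r.xbar k (r.jlast k) - r.x k‖
      = ‖(r.x (k + 1) - r.x k) - (r.x (k + 1) - r.xbar k (r.jlast k))‖ := by congr 1; abel
    _ ≤ ‖r.x (k + 1) - r.x k‖ + ‖r.x (k + 1) - r.xbar k (r.jlast k)‖ := norm_sub_le _ _
    _ ≤ ‖r.x (k + 1) - r.x k‖ + √S * ‖r.x (k + 1) - r.x k‖ := by gcongr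
    _ ≤ (D + N + √S + 1) * ‖r.x (k + 1) - r.x k‖ := by
      have : 0 ≤ (D + N) * ‖r.x (k + 1) - r.x k‖ := by positivity
      linarith

theorem IsRun.tendsto_xbar_sub (hp : BasicAssumption f φ ψ g) (h : IsRun f φ ψ g p r) {C : ℝ}
    {v : ℕ → Vec n} {l : ℕ → Vec m}
    (hkkt : ∀ᶠ k in atTop, IsBoundedKKT f φ g r C k (v k) (l k)) :
    Tendsto (fun k => r.xbar k (r.jlast k) - r.x k) atTop (𝓝 0) := by
  have h1 := (h.tendsto_norm_step hp).const_mul C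
  rw [mul_zero] at h1
  exact squeeze_zero_norm' (hkkt.mono fun k hk => hk.norm_sub) h1

/-- Cluster points of the iterates are strong stationary. -/
theorem IsRun.clusterSet_subset_strongStationary (hp : BasicAssumption f φ ψ g)
    (h : IsRun f φ ψ g p r) (hbdd : Bornology.IsBounded (Set.range r.x)) {C : ℝ}
    {v : ℕ → Vec n} {l : ℕ → Vec m}
    (hkkt : ∀ᶠ k in atTop, IsBoundedKKT f φ g r C k (v k) (l k)) :
    clusterSet r.x ⊆ strongStationary f φ ψ g := by
  intro a ha
  obtain ⟨R, hR, hx, hy⟩ := h.exists_bound hp hbdd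
  obtain ⟨B, hB, hLQ⟩ := h.exists_parameter_bound hp hbdd
  obtain ⟨σ, hσ, hσa⟩ := MapClusterPt.tendsto_subseq ha
  have hφc := continuous_of_convexOn_univ hp.phi_convex
  have hψc := continuous_of_convexOn_univ hp.psi_convex
  have hev : ∀ᶠ i in atTop, (v (σ i), l (σ i), r.xi (σ i)) ∈
      Metric.closedBall (0 : Vec n × Vec m × Vec n) (max C R) := by
    filter_upwards [hσ.tendsto_atTop.eventually hkkt] with i hi
    rw [Metric.mem_closedBall, dist_zero_right]
    simp only [Prod.norm_def]
    exact max_le (hi.norm_v.trans (le_max_left _ _)) (max_le (hi.norm_l.trans (le_max_left _ _))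
      ((hx _).2.2.trans (le_max_right _ _)))
  -- A further subsequence along which the bounded subgradients and multipliers converge as well.
  obtain ⟨⟨v', l', ξ'⟩, -, τ, hτ, hlim⟩ :=
    (isCompact_closedBall _ _).tendsto_subseq' hev.frequently
  have hv' : Tendsto (fun i => v (σ (τ i))) atTop (𝓝 v') :=
    (continuous_fst.tendsto _).comp hlim
  have hl' : Tendsto (fun i => l (σ (τ i))) atTop (𝓝 l') :=
    ((continuous_fst.comp continuous_snd).tendsto _).comp hlim
  have hξ' : Tendsto (fun i => r.xi (σ (τ i))) atTop (𝓝 ξ') :=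
    ((continuous_snd.comp continuous_snd).tendsto _).comp hlim
  have hρ : Tendsto (fun i => σ (τ i)) atTop atTop := hσ.tendsto_atTop.comp hτ.tendsto_atTop
  have hxa : Tendsto (fun i => r.x (σ (τ i))) atTop (𝓝 a) := hσa.comp hτ.tendsto_atTop
  have hd : Tendsto (fun i => r.xbar (σ (τ i)) (r.jlast (σ (τ i))) - r.x (σ (τ i))) atTop (𝓝 0) :=
    (h.tendsto_xbar_sub hp hkkt).comp hρ
  have hxb : Tendsto (fun i => r.xbar (σ (τ i)) (r.jlast (σ (τ i)))) atTop (𝓝 a) := by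
    simpa using hd.add hxa
  have hev' : ∀ᶠ i in atTop, IsBoundedKKT f φ g r C (σ (τ i)) (v (σ (τ i))) (l (σ (τ i))) :=
    hρ.eventually hkkt
  have haΓ : a ∈ feasibleSet g :=
    hp.isClosed_feasibleSet.mem_of_tendsto hxa (Eventually.of_forall fun i => h.mem_feasibleSet _)
  have hvsub : IsSubgrad φ a v' := IsSubgrad.of_tendsto hφc hxb hv' (hev'.mono fun i hi => hi.subgrad)
  have hdn : Tendsto (fun i => ‖r.xbar (σ (τ i)) (r.jlast (σ (τ i))) - r.x (σ (τ i))‖)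
      atTop (𝓝 0) := by simpa using hd.norm
  have hgc : Continuous (fderiv ℝ g) := hp.g_lip.continuous
  have hJd : Tendsto (fun i => fderiv ℝ g (r.x (σ (τ i)))
      (r.xbar (σ (τ i)) (r.jlast (σ (τ i))) - r.x (σ (τ i)))) atTop (𝓝 0) := by
    have := tendsto_clm_apply ((hgc.tendsto a).comp hxa) hd
    rwa [map_zero] at this
  have hLd : Tendsto (fun i => ((1 / 2 : ℝ) * ‖r.xbar (σ (τ i)) (r.jlast (σ (τ i)))
      - r.x (σ (τ i))‖ ^ 2) • r.L (σ (τ i)) (r.jlast (σ (τ i)))) atTop (𝓝 0) := by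
    refine squeeze_zero_norm (a := fun i => (1 / 2 : ℝ) * ‖r.xbar (σ (τ i)) (r.jlast (σ (τ i)))
      - r.x (σ (τ i))‖ ^ 2 * B) (fun i => ?_) ?_
    · rw [norm_smul, Real.norm_of_nonneg (by positivity)]
      exact mul_le_mul_of_nonneg_left (hLQ _).1 (by positivity)
    · simpa using ((hdn.pow 2).const_mul (1 / 2 : ℝ)).mul_const B
  have hball : Tendsto (fun i => ballMap g (r.xbar (σ (τ i)) (r.jlast (σ (τ i)))) (r.x (σ (τ i)))
      (r.L (σ (τ i)) (r.jlast (σ (τ i))))) atTop (𝓝 (g a)) := by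
    have := (((hp.g_diff.continuous.tendsto a).comp hxa).add hJd).add hLd
    rwa [add_zero, add_zero] at this
  have hlN : l' ∈ normalCone (nonposOrthant m) (g a) := by
    refine mem_normalCone_nonposOrthant_iff.2 ⟨haΓ, fun i => ?_, ?_⟩
    · have hi : Tendsto (fun q => l (σ (τ q)) i) atTop (𝓝 (l' i)) :=
        ((EuclideanSpace.proj (𝕜 := ℝ) i).continuous.tendsto _).comp hl'
      exact ge_of_tendsto hi (hev'.mono fun q hq => hq.nonneg i)
    · exact tendsto_nhds_unique_of_eventuallyEq (hl'.inner hball) tendsto_const_nhds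
        (hev'.mono fun q hq => hq.compl)
  have hξ : ξ' ∈ subdiff (fun z => -ψ z) a :=
    mem_limSubdiff_of_tendsto hψc.neg hxa hξ' fun i => h.xi_mem _
  obtain ⟨O, hO, -, hΓ, -, -, hlip⟩ := hp.f_smooth
  have hgrad : Tendsto (fun i => grad f (r.x (σ (τ i)))) atTop (𝓝 (grad f a)) :=
    (hlip.continuousOn.continuousAt (hO.mem_nhds (hΓ haΓ))).tendsto.comp hxa
  have hQd : Tendsto (fun i => r.Q (σ (τ i)) (r.jlast (σ (τ i)))
      (r.xbar (σ (τ i)) (r.jlast (σ (τ i))) - r.x (σ (τ i)))) atTop (𝓝 0) := by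
    refine squeeze_zero_norm (a := fun i => B * ‖r.xbar (σ (τ i)) (r.jlast (σ (τ i)))
      - r.x (σ (τ i))‖) (fun i => ?_) (by simpa using hdn.const_mul B)
    exact (ContinuousLinearMap.le_opNorm _ _).trans
      (mul_le_mul_of_nonneg_right (hLQ _).2 (norm_nonneg _))
  have hjac : Tendsto (fun i => jacT (fun z => ballMap g z (r.x (σ (τ i)))
      (r.L (σ (τ i)) (r.jlast (σ (τ i))))) (r.xbar (σ (τ i)) (r.jlast (σ (τ i)))) (l (σ (τ i))))
      atTop (𝓝 (jacT g a l')) := by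
    simp only [jacT_ballMap]
    have e1 : Tendsto (fun i => jacT g (r.x (σ (τ i))) (l (σ (τ i)))) atTop (𝓝 (jacT g a l')) :=
      tendsto_clm_apply
        (((ContinuousLinearMap.adjoint.continuous.comp hgc).tendsto a).comp hxa) hl'
    have e2 : Tendsto (fun i => inner ℝ (l (σ (τ i))) (r.L (σ (τ i)) (r.jlast (σ (τ i)))) •
        (r.xbar (σ (τ i)) (r.jlast (σ (τ i))) - r.x (σ (τ i)))) atTop (𝓝 0) := by
      refine squeeze_zero_norm' (a := fun i => C * B * ‖r.xbar (σ (τ i)) (r.jlast (σ (τ i)))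
        - r.x (σ (τ i))‖) ?_ (by simpa using hdn.const_mul (C * B))
      filter_upwards [hev'] with i hi
      rw [norm_smul]
      refine mul_le_mul_of_nonneg_right ((norm_inner_le_norm _ _).trans ?_) (norm_nonneg _)
      exact mul_le_mul hi.norm_l (hLQ _).1 (norm_nonneg _) ((norm_nonneg _).trans hi.norm_l)
    simpa using e1.add e2
  refine ⟨haΓ, v', regSubdiff_subset_limSubdiff hvsub.mem_regSubdiff, ξ', hξ, l', hlN, ?_⟩
  -- In the limit of the optimality conditions, the terms with `Q` and `L` vanish because both carry
  -- the factor `xbar - x → 0`.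
  have hlimit := ((hgrad.add hξ').add hQd).add hv' |>.neg
  have := tendsto_nhds_unique_of_eventuallyEq hjac hlimit (hev'.mono fun i hi => hi.kkt)
  rw [this]
  abel

end Multipliers

/-! ### Subgradients of the potential function -/

section Potential

variable {n m : ℕ}

/-- The coordinate `x` of `(x, s, L, ξ, d)`. -/
noncomputable def projX : PotSpace n m →L[ℝ] Vec n :=
  (WithLp.fstL 2 ℝ _ _).comp (WithLp.fstL 2 ℝ _ _)

/-- The coordinate `s` of `(x, s, L, ξ, d)`. -/
noncomputable def projS : PotSpace n m →L[ℝ] Vec n :=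
  (WithLp.fstL 2 ℝ _ _).comp ((WithLp.sndL 2 ℝ _ _).comp (WithLp.fstL 2 ℝ _ _))

/-- The coordinate `L` of `(x, s, L, ξ, d)`. -/
noncomputable def projL : PotSpace n m →L[ℝ] Vec m :=
  (WithLp.fstL 2 ℝ _ _).comp
    ((WithLp.sndL 2 ℝ _ _).comp ((WithLp.sndL 2 ℝ _ _).comp (WithLp.fstL 2 ℝ _ _)))

/-- The coordinate `ξ` of `(x, s, L, ξ, d)`. -/
noncomputable def projXi : PotSpace n m →L[ℝ] Vec n :=
  (WithLp.sndL 2 ℝ _ _).comp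
    ((WithLp.sndL 2 ℝ _ _).comp ((WithLp.sndL 2 ℝ _ _).comp (WithLp.fstL 2 ℝ _ _)))

/-- The coordinate `d` of `(x, s, L, ξ, d)`. -/
noncomputable def projD : PotSpace n m →L[ℝ] Vec n :=
  WithLp.sndL 2 ℝ _ _

theorem norm_projX_le (w : PotSpace n m) : ‖projX w‖ ≤ ‖w‖ :=
  (WithLp.norm_fst_le _ _).trans (WithLp.norm_fst_le _ _)

theorem norm_projS_le (w : PotSpace n m) : ‖projS w‖ ≤ ‖w‖ :=
  (WithLp.norm_fst_le _ _).trans ((WithLp.norm_snd_le _ _).trans (WithLp.norm_fst_le _ _))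

theorem norm_projL_le (w : PotSpace n m) : ‖projL w‖ ≤ ‖w‖ :=
  (WithLp.norm_fst_le _ _).trans ((WithLp.norm_snd_le _ _).trans
    ((WithLp.norm_snd_le _ _).trans (WithLp.norm_fst_le _ _)))

theorem norm_projXi_le (w : PotSpace n m) : ‖projXi w‖ ≤ ‖w‖ :=
  (WithLp.norm_snd_le _ _).trans ((WithLp.norm_snd_le _ _).trans
    ((WithLp.norm_snd_le _ _).trans (WithLp.norm_fst_le _ _)))

theorem norm_projD_le (w : PotSpace n m) : ‖projD w‖ ≤ ‖w‖ :=
  WithLp.norm_snd_le _ _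

variable {f : Vec n → EReal} {φ ψ : Vec n → ℝ} {g : Vec n → Vec m} {c : ℝ}

/-- The value of the potential function at points of the relevant form. -/
theorem potential_potPoint_eq (hp : BasicAssumption f φ ψ g) {x s ξ d : Vec n} {L : Vec m}
    (hf : f x ≠ ⊤) (hL : ∀ i, 0 < L i) (hball : ballMap g x s L ∈ nonposOrthant m)
    (hξ : IsSubgrad ψ s (-ξ)) :
    potential f φ ψ g c (potPoint x s L ξ d) =
      (((f x).toReal + φ x + inner ℝ x ξ + (inner ℝ (-ξ) s - ψ s) + c * ‖d‖ ^ 2 : ℝ) : EReal) := by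
  change f x + (φ x : EReal) + indicatorFn _ (x, s, L) + ((inner ℝ x ξ : ℝ) : EReal)
    + conjugate ψ (-ξ) + ((c * ‖d‖ ^ 2 : ℝ) : EReal) = _
  rw [indicatorFn_of_mem (by exact ⟨hL, hball⟩), conjugate_eq_of_isSubgrad hξ, ← hp.coe_toReal hf, add_zero]
  norm_cast

/-- The nonsmooth terms are minorized one by one: `φ` by the subgradient inequality, the indicator
by a Lagrangian term that is nonpositive on the set, and `ψ*` by its defining supremum at `a`.
Complementarity and Fenchel equality make the bound tight at the base point. -/
theorem le_potential (hp : BasicAssumption f φ ψ g) {v a : Vec n} {x : Vec n} {l : Vec m}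
    (hv : IsSubgrad φ x v) (hl : ∀ i, 0 ≤ l i) {w : PotSpace n m} (hf : f (projX w) ≠ ⊤) :
    (((f (projX w)).toReal + (φ x + inner ℝ v (projX w - x))
      + inner ℝ l (ballMap g (projX w) (projS w) (projL w)) + inner ℝ (projX w) (projXi w)
      + (inner ℝ (-projXi w) a - ψ a) + c * ‖projD w‖ ^ 2 : ℝ) : EReal)
      ≤ potential f φ ψ g c w := by
  change _ ≤ f (projX w) + (φ (projX w) : EReal) + indicatorFn _ (projX w, projS w, projL w)
    + ((inner ℝ (projX w) (projXi w) : ℝ) : EReal) + conjugate ψ (-projXi w)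
    + ((c * ‖projD w‖ ^ 2 : ℝ) : EReal)
  rw [← hp.coe_toReal hf]
  simp only [EReal.coe_add]
  refine add_le_add (add_le_add (add_le_add (add_le_add (add_le_add le_rfl ?_) ?_) le_rfl) ?_)
    le_rfl
  · rw [← EReal.coe_add]
    exact EReal.coe_le_coe_iff.2 (hv _)
  · by_cases hq : (projX w, projS w, projL w) ∈ {q : Vec n × Vec n × Vec m |
        (∀ i, 0 < q.2.2 i) ∧ ballMap g q.1 q.2.1 q.2.2 ∈ nonposOrthant m}
    · rw [indicatorFn_of_mem hq, ← EReal.coe_zero, EReal.coe_le_coe_iff]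
      exact inner_nonpos_of_mem_nonposOrthant hl hq.2
    · rw [indicatorFn_of_notMem hq]
      exact le_top
  · exact le_conjugate ψ a _

/-- The derivative of the smooth minorant of the potential function, in abstract coordinates. -/
theorem exists_hasFDerivAt_minorant {E : Type*} [NormedAddCommGroup E] [NormedSpace ℝ E]
    (X S Ξ D : E →L[ℝ] Vec n) (Λ : E →L[ℝ] Vec m) (w : E) {fr : Vec n → ℝ} {f' : Vec n}
    (hf : HasFDerivAt fr (innerSL ℝ f') (X w)) (hg : DifferentiableAt ℝ g (S w))
    (hg' : DifferentiableAt ℝ (fderiv ℝ g) (S w)) (v : Vec n) (l : Vec m) (a b c : ℝ) :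
    ∃ A : E →L[ℝ] ℝ, HasFDerivAt (fun z => fr (X z) + (a + inner ℝ v (X z - X w))
        + inner ℝ l (ballMap g (X z) (S z) (Λ z)) + inner ℝ (X z) (Ξ z)
        + (inner ℝ (-Ξ z) (S w) - b) + c * ‖D z‖ ^ 2) A w ∧
      ∀ h, A h = inner ℝ (f' + v + jacT (fun z => ballMap g z (S w) (Λ w)) (X w) l + Ξ w) (X h)
        + (inner ℝ l (fderiv ℝ (fderiv ℝ g) (S w) (S h) (X w - S w))
          - inner ℝ l (Λ w) * inner ℝ (X w - S w) (S h))
        + 1 / 2 * ‖X w - S w‖ ^ 2 * inner ℝ l (Λ h) + inner ℝ (X w - S w) (Ξ h)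
        + 2 * c * inner ℝ (D w) (D h) := by
  have hX := X.hasFDerivAt (x := w)
  have hS := S.hasFDerivAt (x := w)
  have hΛ := Λ.hasFDerivAt (x := w)
  have hΞ := Ξ.hasFDerivAt (x := w)
  have h1 : HasFDerivAt (fun z => fr (X z)) ((innerSL ℝ f').comp X) w :=
    HasFDerivAt.comp (g := fr) w hf hX
  have h2 : HasFDerivAt (fun z => a + inner ℝ v (X z - X w)) ((innerSL ℝ v).comp X) w :=
    (((innerSL ℝ v).hasFDerivAt).comp w (hX.sub_const (X w))).const_add a
  have hgS : HasFDerivAt (fun z => g (S z)) ((fderiv ℝ g (S w)).comp S) w :=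
    HasFDerivAt.comp (g := g) w hg.hasFDerivAt hS
  have hg'S : HasFDerivAt (fun z => fderiv ℝ g (S z))
      ((fderiv ℝ (fderiv ℝ g) (S w)).comp S) w :=
    HasFDerivAt.comp (g := fderiv ℝ g) w hg'.hasFDerivAt hS
  have hXS : HasFDerivAt (fun z => X z - S z) (X - S) w := hX.sub hS
  have hb : HasFDerivAt (fun z => ballMap g (X z) (S z) (Λ z)) _ w :=
    (hgS.add (hg'S.clm_apply hXS)).add (((hXS.norm_sq).const_mul (1 / 2 : ℝ)).smul hΛ)
  have h3 : HasFDerivAt (fun z => inner ℝ l (ballMap g (X z) (S z) (Λ z))) _ w :=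
    ((innerSL ℝ l).hasFDerivAt).comp w hb
  have h4 := hX.inner ℝ hΞ
  have h5 : HasFDerivAt (fun z => inner ℝ (-Ξ z) (S w) - b) (-(innerSL ℝ (S w)).comp Ξ) w := by
    have := ((((innerSL ℝ (S w)).hasFDerivAt).comp w hΞ).neg).sub_const b
    refine this.congr_of_eventuallyEq (Eventually.of_forall fun z => ?_)
    change inner ℝ (-Ξ z) (S w) - b = -(inner ℝ (S w) (Ξ z)) - b
    rw [inner_neg_left, real_inner_comm]
  have h6 := ((D.hasFDerivAt (x := w)).norm_sq).const_mul c
  refine ⟨_, ((((h1.add h2).add h3).add h4).add h5).add h6, fun h => ?_⟩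
  -- In the `s`-direction, `g'(s) h` from differentiating `g(s)` cancels against `-g'(s) h` from
  -- `g'(s)(x - s)`; every remaining `s`-term carries the factor `x - s`.
  simp only [add_apply, ContinuousLinearMap.comp_apply, innerSL_apply_apply, sub_apply,
    ContinuousLinearMap.flip_apply, neg_apply, smul_apply, ContinuousLinearMap.smulRight_apply,
    fderivInnerCLM_apply, ContinuousLinearMap.prod_apply, inner_add_left, inner_add_right,
    inner_jacT, fderiv_ballMap_apply, smul_eq_mul, inner_smul_right, inner_sub_right, map_sub,
    inner_sub_left, nsmul_eq_mul, real_inner_comm (Ξ w) (X h)]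
  push_cast
  ring

/-- A regular subgradient of the potential function built from a subgradient of `φ` and a
multiplier. -/
theorem exists_mem_regSubdiff_potential (hp : BasicAssumption f φ ψ g)
    (hg : Differentiable ℝ (fderiv ℝ g)) {O : Set (Vec n)} (hO : IsOpen O)
    (hfO : ∀ x ∈ O, f x ≠ ⊤) (hd : DifferentiableOn ℝ (fun z => (f z).toReal) O)
    {x s ξ d v : Vec n} {L l : Vec m} (hx : x ∈ O) (hL : ∀ i, 0 < L i)
    (hball : ballMap g x s L ∈ nonposOrthant m) (hξ : IsSubgrad ψ s (-ξ)) (hv : IsSubgrad φ x v)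
    (hl : ∀ i, 0 ≤ l i) (hcomp : inner ℝ l (ballMap g x s L) = 0) :
    ∃ V ∈ regSubdiff (potential f φ ψ g c) (potPoint x s L ξ d), ∀ h,
      inner ℝ V h = inner ℝ (grad f x + v + jacT (fun z => ballMap g z s L) x l + ξ) (projX h)
        + (inner ℝ l (fderiv ℝ (fderiv ℝ g) s (projS h) (x - s))
          - inner ℝ l L * inner ℝ (x - s) (projS h))
        + 1 / 2 * ‖x - s‖ ^ 2 * inner ℝ l (projL h) + inner ℝ (x - s) (projXi h)
        + 2 * c * inner ℝ d (projD h) := by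
  obtain ⟨A, hA, hAh⟩ := exists_hasFDerivAt_minorant projX projS projXi projD projL
    (potPoint x s L ξ d) (hasFDerivAt_toReal hO hd (x := projX (potPoint x s L ξ d)) hx)
    (hp.g_diff _) (hg _) v l (φ x) (ψ s) c
  refine ⟨_, mem_regSubdiff_of_minorant hA ?_ ?_, fun h => ?_⟩
  · have : ∀ᶠ z in 𝓝 (potPoint x s L ξ d), projX z ∈ O :=
      (projX (n := n) (m := m)).continuous.continuousAt.eventually (hO.mem_nhds hx)
    filter_upwards [this] with z hz
    exact le_potential (ψ := ψ) (c := c) (a := s) hp hv hl (w := z) (hfO _ hz)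
  · rw [potential_potPoint_eq hp (hfO x hx) hL hball hξ]
    change _ = ((((f x).toReal + (φ x + inner ℝ v (x - x)) + inner ℝ l (ballMap g x s L)
      + inner ℝ x ξ + (inner ℝ (-ξ) s - ψ s) + c * ‖d‖ ^ 2 : ℝ)) : EReal)
    rw [sub_self, inner_zero_right, hcomp, add_zero, add_zero]
  · rw [InnerProductSpace.toDual_symm_apply]
    exact hAh h

end Potential

/-! ### The potential function along a run -/

section Convergence

variable {n m : ℕ} {f : Vec n → EReal} {φ ψ : Vec n → ℝ} {g : Vec n → Vec m} {p : Params}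
  {r : Run n m} {C : ℝ} {v : ℕ → Vec n} {l : ℕ → Vec m}

/-- Uniform smoothness of `f` along the iterates and the exact solutions of the subproblems. -/
theorem IsRun.exists_smooth_bound (hp : BasicAssumption f φ ψ g) (h : IsRun f φ ψ g p r)
    (hbdd : Bornology.IsBounded (Set.range r.x))
    (hkkt : ∀ᶠ k in atTop, IsBoundedKKT f φ g r C k (v k) (l k)) :
    ∃ (O : Set (Vec n)) (B : ℝ), IsOpen O ∧ feasibleSet g ⊆ O ∧ (∀ x ∈ O, f x ≠ ⊤) ∧
      DifferentiableOn ℝ (fun z => (f z).toReal) O ∧ 0 ≤ B ∧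
      ∀ᶠ k in atTop, r.xbar k (r.jlast k) ∈ O ∧
        |(f (r.xbar k (r.jlast k))).toReal - (f (r.x k)).toReal
          - inner ℝ (grad f (r.x k)) (r.xbar k (r.jlast k) - r.x k)|
          ≤ B * ‖r.xbar k (r.jlast k) - r.x k‖ ^ 2 ∧
        ‖grad f (r.xbar k (r.jlast k)) - grad f (r.x k)‖
          ≤ B * ‖r.xbar k (r.jlast k) - r.x k‖ ∧
        |(f (r.x (k + 1))).toReal - (f (r.x k)).toReal
          - inner ℝ (grad f (r.x k)) (r.x (k + 1) - r.x k)| ≤ B * ‖r.x (k + 1) - r.x k‖ ^ 2 := by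
  obtain ⟨R, hR, hx, hy⟩ := h.exists_bound hp hbdd
  obtain ⟨O, hO, -, hΓ, hfO, hd, hlip⟩ := hp.f_smooth
  have hK : IsCompact (Metric.closedBall (0 : Vec n) R ∩ feasibleSet g) :=
    (isCompact_closedBall _ _).inter_right hp.isClosed_feasibleSet
  have hxK : ∀ k, r.x k ∈ Metric.closedBall (0 : Vec n) R ∩ feasibleSet g := fun k =>
    ⟨by simpa using (hx k).1, h.mem_feasibleSet k⟩
  -- The exact solutions are not known to be feasible for `g`. Being asymptotically close to the
  -- iterates, they lie in a compact thickening inside the domain of smoothness.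
  obtain ⟨δ, hδ, hδO⟩ := hK.exists_cthickening_subset_open hO (Set.inter_subset_right.trans hΓ)
  obtain ⟨B, hB, hquad⟩ := exists_quadratic_bound_toReal hO hd hlip (hK.cthickening (r := δ)) hδO
  refine ⟨O, B, hO, hΓ, hfO, hd, hB, ?_⟩
  have hsmall : ∀ᶠ k in atTop, ‖r.xbar k (r.jlast k) - r.x k‖ < δ := by
    have := (h.tendsto_xbar_sub hp hkkt).norm
    rw [norm_zero] at this
    exact this.eventually (gt_mem_nhds hδ)
  filter_upwards [hsmall] with k hk
  have hmem : ∀ k, r.x k ∈ Metric.cthickening δ (Metric.closedBall (0 : Vec n) R ∩ feasibleSet g) :=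
    fun k => Metric.self_subset_cthickening _ (hxK k)
  have hxb : r.xbar k (r.jlast k) ∈
      Metric.cthickening δ (Metric.closedBall (0 : Vec n) R ∩ feasibleSet g) :=
    Metric.mem_cthickening_of_dist_le _ _ _ _ (hxK k) (by rw [dist_eq_norm]; exact hk.le)
  have h1 := hquad _ (hmem k) _ hxb
  exact ⟨hδO hxb, h1.1, h1.2, (hquad _ (hmem k) _ (hmem (k + 1))).1⟩

/-- Relative error bound for the potential function at the points
`(xbarᵏ, xᵏ, Lᵏ, ξᵏ, ρ (xᵏ⁺¹ - xᵏ))`. -/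
theorem IsRun.exists_subgradient_bound (hp : BasicAssumption f φ ψ g) (h : IsRun f φ ψ g p r)
    (hbdd : Bornology.IsBounded (Set.range r.x)) (hg : Differentiable ℝ (fderiv ℝ g))
    (hC : 0 < C) (hkkt : ∀ᶠ k in atTop, IsBoundedKKT f φ g r C k (v k) (l k)) (c ρ : ℝ) :
    ∃ b, 0 < b ∧ ∀ᶠ k in atTop, ∃ V ∈ limSubdiff (potential f φ ψ g c)
        (potPoint (r.xbar k (r.jlast k)) (r.x k) (r.L k (r.jlast k)) (r.xi k)
          (ρ • (r.x (k + 1) - r.x k))),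
      ‖V‖ ≤ b * ‖r.x (k + 1) - r.x k‖ := by
  obtain ⟨R, hR, hx, hy⟩ := h.exists_bound hp hbdd
  obtain ⟨B, hB, hLQ⟩ := h.exists_parameter_bound hp hbdd
  obtain ⟨O, D, hO, -, hfO, hd, hD, hsm⟩ := h.exists_smooth_bound hp hbdd hkkt
  obtain ⟨G, hG, hquad⟩ := exists_quadratic_bound_closedBall hp.g_diff hp.g_lip (R + 1)
  -- The Lipschitz constant of `g'` bounds `g''`, so continuity of `g''` is not needed. The radius
  -- `R + 1` leaves room for a neighbourhood of `s`.
  have hG2 : ∀ s : Vec n, ‖s‖ ≤ R → ‖fderiv ℝ (fderiv ℝ g) s‖ ≤ G := by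
    intro s hs
    refine norm_fderiv_le_of_lip' ℝ hG ?_
    have hnear : ∀ᶠ z : Vec n in 𝓝 s, ‖z‖ < R + 1 :=
      (continuous_norm.tendsto s).eventually (gt_mem_nhds (by linarith))
    filter_upwards [hnear] with z hz
    exact (hquad s (by linarith) z hz.le).2
  -- The summands bound the blocks in `x`, `s`, `L`, `ξ` and `d`; the outer `C` converts `‖xbar -
  -- x‖` into the step length.
  refine ⟨((D + B) + (C * G + C * B) + R * C + 1) * C + 2 * |c| * |ρ| , by positivity, ?_⟩
  filter_upwards [hkkt, hsm] with k hk hsk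
  set xb := r.xbar k (r.jlast k) with hxb
  set s := r.x k with hs
  obtain ⟨V, hV, hVh⟩ := exists_mem_regSubdiff_potential (c := c) (d := ρ • (r.x (k + 1) - s)) hp hg
    hO hfO hd hsk.1 (fun i => p.LMin_pos.trans_le (h.LMin_le k _ le_rfl i))
    (h.xbar_mem k _ le_rfl) (h.isSubgrad_xi hp k) hk.subgrad hk.nonneg hk.compl
  refine ⟨V, regSubdiff_subset_limSubdiff hV, ?_⟩
  set N := ‖xb - s‖ with hN
  have hN0 : 0 ≤ N := norm_nonneg _
  have hNR : N ≤ 2 * R := by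
    have := norm_sub_le xb s
    have := (hy k _ le_rfl).2
    have := (hx k).1
    linarith
  have hl0 : 0 ≤ ‖l k‖ := norm_nonneg _
  have e1 : ‖grad f xb + v k + jacT (fun z => ballMap g z s (r.L k (r.jlast k))) xb (l k) + r.xi k‖
      ≤ (D + B) * N := by
    rw [hk.kkt, show grad f xb + v k
      + -(grad f s + r.xi k + r.Q k (r.jlast k) (xb - s) + v k) + r.xi k
      = (grad f xb - grad f s) - r.Q k (r.jlast k) (xb - s) by abel]
    refine (norm_sub_le _ _).trans ?_
    rw [add_mul]
    refine add_le_add hsk.2.2.1 ((ContinuousLinearMap.le_opNorm _ _).trans ?_)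
    exact mul_le_mul_of_nonneg_right (hLQ k).2 hN0
  -- The formula for `⟨V, h⟩` is evaluated at `h = V`, and one factor `‖V‖` is cancelled afterwards.
  have key : ‖V‖ ^ 2 ≤ (((D + B) + (C * G + C * B) + R * C + 1) * N
      + 2 * |c| * |ρ| * ‖r.x (k + 1) - s‖) * ‖V‖ := by
    rw [← real_inner_self_eq_norm_sq, hVh V]
    have a1 : inner ℝ (grad f xb + v k + jacT (fun z => ballMap g z s (r.L k (r.jlast k))) xb (l k)
        + r.xi k) (projX V) ≤ (D + B) * N * ‖V‖ :=
      (real_inner_le_norm _ _).trans (mul_le_mul e1 (norm_projX_le V) (norm_nonneg _)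
        (by positivity))
    have a2 : inner ℝ (l k) (fderiv ℝ (fderiv ℝ g) s (projS V) (xb - s)) ≤ C * G * N * ‖V‖ := by
      refine (real_inner_le_norm _ _).trans ?_
      have : ‖fderiv ℝ (fderiv ℝ g) s (projS V) (xb - s)‖ ≤ G * ‖V‖ * N := by
        refine (ContinuousLinearMap.le_opNorm _ _).trans (mul_le_mul_of_nonneg_right ?_ hN0)
        refine (ContinuousLinearMap.le_opNorm _ _).trans ?_
        exact mul_le_mul (hG2 s (hx k).1) (norm_projS_le V) (norm_nonneg _) hG
      calc _ ≤ C * (G * ‖V‖ * N) := mul_le_mul hk.norm_l this (norm_nonneg _) hC.le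
        _ = _ := by ring
    have a3 : -(inner ℝ (l k) (r.L k (r.jlast k)) * inner ℝ (xb - s) (projS V))
        ≤ C * B * N * ‖V‖ := by
      refine (neg_le_abs _).trans ?_
      rw [abs_mul]
      have b1 : |inner ℝ (l k) (r.L k (r.jlast k))| ≤ C * B := (abs_real_inner_le_norm _ _).trans
        (mul_le_mul hk.norm_l (hLQ k).1 (norm_nonneg _) hC.le)
      have b2 : |inner ℝ (xb - s) (projS V)| ≤ N * ‖V‖ := (abs_real_inner_le_norm _ _).trans
        (mul_le_mul_of_nonneg_left (norm_projS_le V) hN0)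
      calc _ ≤ C * B * (N * ‖V‖) := mul_le_mul b1 b2 (abs_nonneg _) (by positivity)
        _ = _ := by ring
    have a4 : 1 / 2 * N ^ 2 * inner ℝ (l k) (projL V) ≤ R * C * N * ‖V‖ := by
      have b1 : inner ℝ (l k) (projL V) ≤ C * ‖V‖ := (real_inner_le_norm _ _).trans
        (mul_le_mul hk.norm_l (norm_projL_le V) (norm_nonneg _) hC.le)
      have b2 : 1 / 2 * N ^ 2 ≤ R * N := by nlinarith
      calc _ ≤ 1 / 2 * N ^ 2 * (C * ‖V‖) := mul_le_mul_of_nonneg_left b1 (by positivity)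
        _ ≤ R * N * (C * ‖V‖) := mul_le_mul_of_nonneg_right b2 (by positivity)
        _ = _ := by ring
    have a5 : inner ℝ (xb - s) (projXi V) ≤ N * ‖V‖ := (real_inner_le_norm _ _).trans
      (mul_le_mul_of_nonneg_left (norm_projXi_le V) hN0)
    have a6 : 2 * c * inner ℝ (ρ • (r.x (k + 1) - s)) (projD V)
        ≤ 2 * |c| * |ρ| * ‖r.x (k + 1) - s‖ * ‖V‖ := by
      refine (le_abs_self _).trans ?_
      rw [abs_mul, abs_mul, abs_two]
      have : |inner ℝ (ρ • (r.x (k + 1) - s)) (projD V)| ≤ |ρ| * ‖r.x (k + 1) - s‖ * ‖V‖ := by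
        refine (abs_real_inner_le_norm _ _).trans ?_
        rw [norm_smul, Real.norm_eq_abs]
        exact mul_le_mul_of_nonneg_left (norm_projD_le V) (by positivity)
      calc _ ≤ 2 * |c| * (|ρ| * ‖r.x (k + 1) - s‖ * ‖V‖) :=
          mul_le_mul_of_nonneg_left this (by positivity)
        _ = _ := by ring
    linarith
  have hV0 : ‖V‖ ≤ ((D + B) + (C * G + C * B) + R * C + 1) * N
      + 2 * |c| * |ρ| * ‖r.x (k + 1) - s‖ := by
    rcases (norm_nonneg V).eq_or_lt with h0 | h0
    · rw [← h0]; positivity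
    · rw [sq] at key
      exact le_of_mul_le_mul_right key h0
  refine hV0.trans ?_
  have : ((D + B) + (C * G + C * B) + R * C + 1) * N
      ≤ ((D + B) + (C * G + C * B) + R * C + 1) * (C * ‖r.x (k + 1) - s‖) :=
    mul_le_mul_of_nonneg_left hk.norm_sub (by positivity)
  linarith

/-- The real value of the potential function at `(xbarᵏ, xᵏ, Lᵏ, ξᵏ, ρ (xᵏ⁺¹ - xᵏ))`. -/
noncomputable def potValue (f : Vec n → EReal) (φ ψ : Vec n → ℝ) (c ρ : ℝ) (r : Run n m)
    (k : ℕ) : ℝ :=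
  (f (r.xbar k (r.jlast k))).toReal + φ (r.xbar k (r.jlast k))
    + inner ℝ (r.xbar k (r.jlast k)) (r.xi k) + (inner ℝ (-r.xi k) (r.x k) - ψ (r.x k))
    + c * ‖ρ • (r.x (k + 1) - r.x k)‖ ^ 2

theorem IsRun.potential_eq_potValue (hp : BasicAssumption f φ ψ g) (h : IsRun f φ ψ g p r)
    {k : ℕ} (hf : f (r.xbar k (r.jlast k)) ≠ ⊤) (c ρ : ℝ) :
    potential f φ ψ g c (potPoint (r.xbar k (r.jlast k)) (r.x k) (r.L k (r.jlast k)) (r.xi k)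
      (ρ • (r.x (k + 1) - r.x k))) = (potValue f φ ψ c ρ r k : EReal) :=
  potential_potPoint_eq hp hf (fun i => p.LMin_pos.trans_le (h.LMin_le k _ le_rfl i))
    (h.xbar_mem k _ le_rfl) (h.isSubgrad_xi hp k)

/-- For large `ρ` the values of the potential function dominate those of the objective. -/
theorem IsRun.exists_realObjective_le_potValue (hp : BasicAssumption f φ ψ g)
    (h : IsRun f φ ψ g p r) (hbdd : Bornology.IsBounded (Set.range r.x))
    (hkkt : ∀ᶠ k in atTop, IsBoundedKKT f φ g r C k (v k) (l k)) {c : ℝ} (hc : 0 < c) :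
    ∃ ρ : ℝ, ∀ᶠ k in atTop, realObjective f φ ψ (r.x (k + 1)) ≤ potValue f φ ψ c ρ r k := by
  obtain ⟨B, hB, hLQ⟩ := h.exists_parameter_bound hp hbdd
  obtain ⟨O, D, hO, -, hfO, hd, hD, hsm⟩ := h.exists_smooth_bound hp hbdd hkkt
  have hβ := p.betaF_pos
  -- Passing from `F(x^{k+1})` to the potential at `xbar` costs the linearization error of `f` at
  -- `x^{k+1}`, the subproblem gap, and the errors at `xbar` in `f` and the `Q`-term. The choice `ρ
  -- = √(A / c)` makes the last term of the potential pay for them.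
  set A : ℝ := D + p.betaF / 2 + (D + B) * C ^ 2 with hA
  have hA0 : 0 ≤ A := by positivity
  refine ⟨√(A / c), ?_⟩
  filter_upwards [hkkt, hsm] with k hk hsk
  have hρ : c * ‖√(A / c) • (r.x (k + 1) - r.x k)‖ ^ 2 = A * ‖r.x (k + 1) - r.x k‖ ^ 2 := by
    rw [norm_smul, Real.norm_of_nonneg (Real.sqrt_nonneg _), mul_pow,
      Real.sq_sqrt (by positivity), ← mul_assoc, mul_div_cancel₀ _ hc.ne']
  unfold potValue realObjective
  rw [hρ]
  have h1 := h.gap_le k _ le_rfl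
  rw [← h.next] at h1
  have h2 := subObj_sub (f := f) (φ := φ) (ψ := ψ) (s := r.x k) (ξ := r.xi k) (x := r.x k)
    (h.isPositive_Q (le_refl (r.jlast k))).isSymmetric (r.x (k + 1))
  have h3 := subObj_sub (f := f) (φ := φ) (ψ := ψ) (s := r.x k) (ξ := r.xi k) (x := r.x k)
    (h.isPositive_Q (le_refl (r.jlast k))).isSymmetric (r.xbar k (r.jlast k))
  rw [sub_self, map_zero, add_zero, inner_add_left] at h2 h3
  have h4 := (abs_le.1 hsk.2.1).1
  have h5 := (abs_le.1 hsk.2.2.2).2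
  have h6 := h.isSubgrad_xi hp k (r.x (k + 1))
  rw [inner_neg_left] at h6
  have h7 : 0 ≤ inner ℝ (r.x (k + 1) - r.x k) (r.Q k (r.jlast k) (r.x (k + 1) - r.x k)) :=
    (h.isPositive_Q le_rfl).inner_nonneg_right _
  have h8 : inner ℝ (r.xbar k (r.jlast k) - r.x k)
      (r.Q k (r.jlast k) (r.xbar k (r.jlast k) - r.x k))
      ≤ B * ‖r.xbar k (r.jlast k) - r.x k‖ ^ 2 := by
    refine (real_inner_le_norm _ _).trans ?_
    rw [sq, mul_left_comm]
    refine mul_le_mul_of_nonneg_left ((ContinuousLinearMap.le_opNorm _ _).trans ?_)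
      (norm_nonneg _)
    exact mul_le_mul_of_nonneg_right (hLQ k).2 (norm_nonneg _)
  have h9 : inner ℝ (r.xbar k (r.jlast k)) (r.xi k) + inner ℝ (-r.xi k) (r.x k)
      = inner ℝ (r.xi k) (r.xbar k (r.jlast k) - r.x k) := by
    rw [inner_neg_left, inner_sub_right, real_inner_comm]
    ring
  have h10 : (D + B) * ‖r.xbar k (r.jlast k) - r.x k‖ ^ 2
      ≤ (D + B) * C ^ 2 * ‖r.x (k + 1) - r.x k‖ ^ 2 := by
    rw [mul_assoc, ← mul_pow]
    have := hk.norm_sub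
    gcongr
  have h11 : A * ‖r.x (k + 1) - r.x k‖ ^ 2 = D * ‖r.x (k + 1) - r.x k‖ ^ 2
      + p.betaF / 2 * ‖r.x (k + 1) - r.x k‖ ^ 2
      + (D + B) * C ^ 2 * ‖r.x (k + 1) - r.x k‖ ^ 2 := by rw [hA]; ring
  have h12 : 0 ≤ B * ‖r.xbar k (r.jlast k) - r.x k‖ ^ 2 := by positivity
  linarith

/-- Squeezed between `F(x^{k+1})` and `F(x^k)` plus a vanishing error: `xbar^k - x^k → 0`, while
`∇f(x^k)`, `v^k` and `ξ^k` are bounded. -/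
theorem IsRun.tendsto_potValue (hp : BasicAssumption f φ ψ g) (h : IsRun f φ ψ g p r)
    (hbdd : Bornology.IsBounded (Set.range r.x))
    (hkkt : ∀ᶠ k in atTop, IsBoundedKKT f φ g r C k (v k) (l k)) {c ρ F : ℝ}
    (hF : Tendsto (fun k => realObjective f φ ψ (r.x k)) atTop (𝓝 F))
    (hle : ∀ᶠ k in atTop, realObjective f φ ψ (r.x (k + 1)) ≤ potValue f φ ψ c ρ r k) :
    Tendsto (potValue f φ ψ c ρ r) atTop (𝓝 F) := by
  obtain ⟨R, hR, hx, hy⟩ := h.exists_bound hp hbdd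
  obtain ⟨O, D, hO, -, hfO, hd, hD, hsm⟩ := h.exists_smooth_bound hp hbdd hkkt
  have hN : Tendsto (fun k => ‖r.xbar k (r.jlast k) - r.x k‖) atTop (𝓝 0) := by
    simpa using (h.tendsto_xbar_sub hp hkkt).norm
  have hS : Tendsto (fun k => c * ‖ρ • (r.x (k + 1) - r.x k)‖ ^ 2) atTop (𝓝 0) := by
    have := (((h.tendsto_norm_step hp).const_mul |ρ|).pow 2).const_mul c
    simpa [norm_smul] using this
  have hupper : Tendsto (fun k => realObjective f φ ψ (r.x k)
      + (D * ‖r.xbar k (r.jlast k) - r.x k‖ ^ 2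
        + (R + C + R) * ‖r.xbar k (r.jlast k) - r.x k‖)
      + c * ‖ρ • (r.x (k + 1) - r.x k)‖ ^ 2) atTop (𝓝 F) := by
    have := (hF.add (((hN.pow 2).const_mul D).add (hN.const_mul (R + C + R)))).add hS
    simpa using this
  refine tendsto_of_tendsto_of_tendsto_of_le_of_le' (hF.comp (tendsto_add_atTop_nat 1)) hupper
    hle ?_
  filter_upwards [hkkt, hsm] with k hk hsk
  unfold potValue realObjective
  have h1 := (abs_le.1 hsk.2.1).2
  have h2 : inner ℝ (grad f (r.x k)) (r.xbar k (r.jlast k) - r.x k)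
      ≤ R * ‖r.xbar k (r.jlast k) - r.x k‖ := (real_inner_le_norm _ _).trans
    (mul_le_mul_of_nonneg_right (hx k).2.1 (norm_nonneg _))
  have h3 : inner ℝ (v k) (r.xbar k (r.jlast k) - r.x k)
      ≤ C * ‖r.xbar k (r.jlast k) - r.x k‖ := (real_inner_le_norm _ _).trans
    (mul_le_mul_of_nonneg_right hk.norm_v (norm_nonneg _))
  have h4 := hk.subgrad (r.x k)
  rw [← neg_sub (r.xbar k (r.jlast k)), inner_neg_right] at h4
  have h5 : inner ℝ (r.xbar k (r.jlast k)) (r.xi k) + inner ℝ (-r.xi k) (r.x k)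
      = inner ℝ (r.xi k) (r.xbar k (r.jlast k) - r.x k) := by
    rw [inner_neg_left, inner_sub_right, real_inner_comm]
    ring
  have h6 : inner ℝ (r.xi k) (r.xbar k (r.jlast k) - r.x k)
      ≤ R * ‖r.xbar k (r.jlast k) - r.x k‖ := (real_inner_le_norm _ _).trans
    (mul_le_mul_of_nonneg_right (hx k).2.2 (norm_nonneg _))
  linarith

/-- The potential function is constant on the cluster set. -/
theorem IsRun.potential_eq_of_mem_clusterSet (hp : BasicAssumption f φ ψ g)
    (h : IsRun f φ ψ g p r)
    (hkkt : ∀ᶠ k in atTop, IsBoundedKKT f φ g r C k (v k) (l k)) {c F : ℝ}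
    (hF : Tendsto (fun k => realObjective f φ ψ (r.x k)) atTop (𝓝 F)) {w : PotSpace n m}
    (hw : w ∈ clusterSet (potSeq r)) : potential f φ ψ g c w = F := by
  obtain ⟨σ, hσ, hlim⟩ := MapClusterPt.tendsto_subseq hw
  obtain ⟨O, hO, -, hΓ, hfO, hd, -⟩ := hp.f_smooth
  have hφc := continuous_of_convexOn_univ hp.phi_convex
  have hψc := continuous_of_convexOn_univ hp.psi_convex
  have hX : Tendsto (fun i => r.xbar (σ i) (r.jlast (σ i))) atTop (𝓝 (projX w)) :=
    (projX.continuous.tendsto w).comp hlim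
  have hS : Tendsto (fun i => r.x (σ i)) atTop (𝓝 (projS w)) :=
    (projS.continuous.tendsto w).comp hlim
  have hL : Tendsto (fun i => r.L (σ i) (r.jlast (σ i))) atTop (𝓝 (projL w)) :=
    (projL.continuous.tendsto w).comp hlim
  have hΞ : Tendsto (fun i => r.xi (σ i)) atTop (𝓝 (projXi w)) :=
    (projXi.continuous.tendsto w).comp hlim
  have hD : Tendsto (fun i => r.x (σ i + 1) - r.x (σ i)) atTop (𝓝 (projD w)) :=
    (projD.continuous.tendsto w).comp hlim
  have hXS : projX w = projS w := by
    refine tendsto_nhds_unique hX ?_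
    simpa using ((h.tendsto_xbar_sub hp hkkt).comp hσ.tendsto_atTop).add hS
  have hD0 : projD w = 0 :=
    tendsto_nhds_unique hD
      ((tendsto_zero_iff_norm_tendsto_zero.2 (h.tendsto_norm_step hp)).comp hσ.tendsto_atTop)
  have hfeas : projS w ∈ feasibleSet g :=
    hp.isClosed_feasibleSet.mem_of_tendsto hS (Eventually.of_forall fun i => h.mem_feasibleSet _)
  have hLpos : ∀ i, 0 < projL w i := fun i => by
    have hi : Tendsto (fun q => r.L (σ q) (r.jlast (σ q)) i) atTop (𝓝 (projL w i)) :=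
      ((EuclideanSpace.proj (𝕜 := ℝ) i).continuous.tendsto _).comp hL
    exact p.LMin_pos.trans_le
      (ge_of_tendsto hi (Eventually.of_forall fun q => h.LMin_le _ _ le_rfl i))
  have hsub : IsSubgrad ψ (projS w) (-projXi w) :=
    IsSubgrad.of_tendsto hψc hS hΞ.neg (Eventually.of_forall fun i => h.isSubgrad_xi hp _)
  -- At a cluster point `x = s` and `d = 0`, so the model constraint reduces to `g s ≤ 0` and the
  -- potential to `f + φ - ψ`.
  have hwe : w = potPoint (projS w) (projS w) (projL w) (projXi w) 0 := by
    conv_rhs => rw [← hD0]; arg 1; rw [← hXS]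
    rfl
  have hfc : ContinuousAt (fun z => (f z).toReal) (projS w) :=
    (hd.differentiableAt (hO.mem_nhds (hΓ hfeas))).continuousAt
  have hobj : Tendsto (fun i => realObjective f φ ψ (r.x (σ i))) atTop
      (𝓝 (realObjective f φ ψ (projS w))) :=
    (hfc.tendsto.comp hS).add
      (((hφc.tendsto _).comp hS).sub ((hψc.tendsto _).comp hS))
  rw [← tendsto_nhds_unique hobj (hF.comp hσ.tendsto_atTop), hwe,
    potential_potPoint_eq hp (hfO _ (hΓ hfeas)) hLpos (by rw [ballMap_self]; exact hfeas) hsub,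
    EReal.coe_eq_coe_iff, ← hwe]
  unfold realObjective
  rw [norm_zero, inner_neg_left, real_inner_comm]
  ring

theorem IsRun.exists_isCompact_potSeq (hp : BasicAssumption f φ ψ g) (h : IsRun f φ ψ g p r)
    (hbdd : Bornology.IsBounded (Set.range r.x)) :
    ∃ K : Set (PotSpace n m), IsCompact K ∧ ∀ k, potSeq r k ∈ K := by
  obtain ⟨R, hR, hx, hy⟩ := h.exists_bound hp hbdd
  obtain ⟨B, hB, hLQ⟩ := h.exists_parameter_bound hp hbdd
  refine ⟨Metric.closedBall 0 (R + R + B + R + (R + R)), isCompact_closedBall _ _, fun k => ?_⟩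
  have hle : ∀ (E F : Type) [NormedAddCommGroup E] [NormedAddCommGroup F] (a : E) (b : F),
      ‖WithLp.toLp 2 (a, b)‖ ≤ ‖a‖ + ‖b‖ := by
    intro E F _ _ a b
    refine le_of_sq_le_sq ?_ (by positivity)
    rw [WithLp.prod_norm_sq_eq_of_L2]
    change ‖a‖ ^ 2 + ‖b‖ ^ 2 ≤ _
    nlinarith [norm_nonneg a, norm_nonneg b]
  rw [Metric.mem_closedBall, dist_zero_right]
  have hs : ‖r.x (k + 1) - r.x k‖ ≤ R + R :=
    (norm_sub_le _ _).trans (add_le_add (hx _).1 (hx _).1)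
  refine (hle _ _ _ _).trans (add_le_add ?_ hs)
  refine (hle _ _ _ _).trans ?_
  have h1 := hle _ _ (r.L k (r.jlast k)) (r.xi k)
  have h2 := hle _ _ (r.x k) (WithLp.toLp 2 (r.L k (r.jlast k), r.xi k))
  have h3 := (hy k _ (le_refl (r.jlast k))).2
  have h4 := (hx k).1
  have h5 := (hx k).2.2
  have h6 := (hLQ k).1
  linarith

/-- The step lengths of a run are summable if the potential function has the
Kurdyka-Łojasiewicz property on the cluster set. -/
theorem IsRun.summable_norm_step (hp : BasicAssumption f φ ψ g) (h : IsRun f φ ψ g p r)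
    (hbdd : Bornology.IsBounded (Set.range r.x)) (hg : Differentiable ℝ (fderiv ℝ g))
    (hC : 0 < C) (hkkt : ∀ᶠ k in atTop, IsBoundedKKT f φ g r C k (v k) (l k)) {c : ℝ}
    (hc : 0 < c) (hKL : ∀ w ∈ clusterSet (potSeq r), HasKLAt (potential f φ ψ g c) w) :
    Summable fun k => ‖r.x (k + 1) - r.x k‖ := by
  obtain ⟨F, hF, hFle⟩ := h.exists_tendsto_realObjective hp
  obtain ⟨ρ, hρ⟩ := h.exists_realObjective_le_potValue hp hbdd hkkt hc
  have hval := h.tendsto_potValue hp hbdd hkkt hF hρ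
  obtain ⟨b, hb, hsubg⟩ := h.exists_subgradient_bound hp hbdd hg hC hkkt c ρ
  obtain ⟨O, _, -, -, hfO, -, -, hsm⟩ := h.exists_smooth_bound hp hbdd hkkt
  obtain ⟨K, hK, hKmem⟩ := h.exists_isCompact_potSeq hp hbdd
  choose! δ hδ η hη θ hθ hineq using fun q hq => (hKL q hq).2
  -- Half the KL radius is kept for the distance between `potSeq r k` and its rescaled version `w
  -- k`.
  obtain ⟨T, hT, hcov⟩ := exists_finset_cover_clusterSet hK (Eventually.of_forall hKmem)
    (V := fun q => Metric.ball q (δ q / 2))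
    (fun q hq => Metric.ball_mem_nhds q (half_pos (hδ q hq)))
  set w : ℕ → PotSpace n m := fun k => potPoint (r.xbar k (r.jlast k)) (r.x k)
    (r.L k (r.jlast k)) (r.xi k) (ρ • (r.x (k + 1) - r.x k)) with hw
  have hstep : Tendsto (fun k => r.x (k + 1) - r.x k) atTop (𝓝 0) :=
    tendsto_zero_iff_norm_tendsto_zero.2 (h.tendsto_norm_step hp)
  have hdist : Tendsto (fun k => dist (w k) (potSeq r k)) atTop (𝓝 0) := by
    have hsub : ∀ k, w k - potSeq r k =
        potPoint 0 0 0 0 (ρ • (r.x (k + 1) - r.x k) - (r.x (k + 1) - r.x k)) := by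
      intro k
      simp only [hw, potSeq, potPoint, ← WithLp.toLp_sub, Prod.mk_sub_mk, sub_self]
      rfl
    have hcont : Continuous fun d : Vec n => (potPoint 0 0 0 0 d : PotSpace n m) :=
      (WithLp.prod_continuous_toLp 2 _ _).comp (continuous_const.prodMk continuous_id)
    have h0 : (potPoint 0 0 0 0 0 : PotSpace n m) = 0 := rfl
    have h1 := (hcont.tendsto _).comp ((hstep.const_smul ρ).sub hstep)
    rw [smul_zero, sub_zero, h0] at h1
    have h2 := h1.norm
    rw [norm_zero] at h2
    refine h2.congr fun k => ?_
    rw [dist_eq_norm, hsub]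
    rfl
  have hnear : ∀ᶠ k in atTop, ∀ q ∈ T, dist (w k) (potSeq r k) < δ q / 2 := by
    rw [Filter.eventually_all_finset]
    exact fun q hq => hdist.eventually (gt_mem_nhds (half_pos (hδ q (hT q hq))))
  have hlt : ∀ᶠ k in atTop, ∀ q ∈ T, ((potValue f φ ψ c ρ r k - F : ℝ) : EReal) < η q := by
    rw [Filter.eventually_all_finset]
    intro q hq
    have h1 : Tendsto (fun k => ((potValue f φ ψ c ρ r k - F : ℝ) : EReal)) atTop
        (𝓝 ((F - F : ℝ) : EReal)) :=
      (continuous_coe_real_ereal.tendsto _).comp (hval.sub_const F)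
    refine h1.eventually (gt_mem_nhds ?_)
    rw [sub_self]
    exact hη q (hT q hq)
  refine summable_of_desingularizing T (η := η) (θ := θ) (D := fun k => ‖r.x (k + 1) - r.x k‖)
    (r := fun k => realObjective f φ ψ (r.x k) - F) (a := p.alpha / 2) (b := b)
    (fun q hq => hη q (hT q hq)) (fun q hq => hθ q (hT q hq)) (half_pos p.alpha_pos) hb
    (fun k => norm_nonneg _) (fun k => sub_nonneg.2 (hFle k)) ?_ (fun k => ?_) ?_
  · simpa using hF.sub_const F
  · have := h.descent_realObjective hp k
    linarith
  · filter_upwards [hcov, hnear, hlt, hρ, hsubg, hsm] with k hk hnk hlk hρk hsk hsmk hpos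
    obtain ⟨q, hq, hqk⟩ := hk
    have hqc := hT q hq
    obtain ⟨V, hV, hVn⟩ := hsk
    -- The excess of the potential dominates `F(x^{k+1}) - F > 0`, so the KL inequality applies at
    -- `w k` with a strict inequality of values.
    refine ⟨q, hq, potValue f φ ψ c ρ r k - F, by linarith, hlk q hq, ?_⟩
    have hv1 : potential f φ ψ g c (w k) = (potValue f φ ψ c ρ r k : EReal) :=
      h.potential_eq_potValue hp (hfO _ hsmk.1) c ρ
    have hv2 : potential f φ ψ g c q = (F : EReal) :=
      h.potential_eq_of_mem_clusterSet hp hkkt hF hqc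
    have hball : w k ∈ Metric.closedBall q (δ q) := by
      have h1 : dist (potSeq r k) q < δ q / 2 := hqk
      have h2 := hnk q hq
      have h3 := dist_triangle (w k) (potSeq r k) q
      rw [Metric.mem_closedBall]
      linarith
    have hKLk := hineq q hqc (w k) hball
      (by rw [hv1, hv2, EReal.coe_lt_coe_iff]; linarith)
      (by
        rw [hv1, hv2]
        have := EReal.add_lt_add_left_coe (hlk q hq) F
        rwa [← EReal.coe_add, add_sub_cancel] at this)
    rw [hv1, hv2, EReal.toReal_coe, EReal.toReal_coe] at hKLk
    have hinf : Metric.infEDist 0 (limSubdiff (potential f φ ψ g c) (w k))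
        ≤ ENNReal.ofReal (b * ‖r.x (k + 1) - r.x k‖) := by
      refine (Metric.infEDist_le_edist_of_mem hV).trans ?_
      rw [edist_dist, dist_zero_left]
      exact ENNReal.ofReal_le_ofReal hVn
    have hfin := hKLk.trans (mul_le_mul_right hinf _)
    rw [← ENNReal.ofReal_mul' (by positivity)] at hfin
    exact ENNReal.one_le_ofReal.1 hfin

end Convergence

end InexactMBA

theorem theorem4p5 {n m : ℕ} (f : Vec n → EReal) (φ ψ : Vec n → ℝ) (g : Vec n → Vec m)
    (hprob : BasicAssumption f φ ψ g)
    (p : Params) (r : Run n m) (hrun : IsRun f φ ψ g p r)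
    (hsubreg : SubproblemsSubregular g r)
    (hbdd : Bornology.IsBounded (Set.range r.x))
    (hBMP : ∀ q ∈ clusterSet (paramSeq r),
      PartialBMP (paramSet n m) (paramConstraint g) q.1 q.2)
    (hg : Differentiable ℝ (fderiv ℝ g))
    (c : ℝ) (hc : 0 < c)
    (hKL : ∀ w ∈ clusterSet (potSeq r), HasKLAt (potential f φ ψ g c) w) :
    Summable (fun k => ‖r.x (k + 1) - r.x k‖) ∧
      clusterSet r.x ⊆ strongStationary f φ ψ g ∧
      ∃ a ∈ clusterSet r.x, Tendsto r.x atTop (𝓝 a) := by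
  obtain ⟨C, hC, v, l, hkkt⟩ := hrun.exists_isBoundedKKT hprob hbdd hBMP
  have hsum := hrun.summable_norm_step hprob hbdd hg hC hkkt hc hKL
  refine ⟨hsum, hrun.clusterSet_subset_strongStationary hprob hbdd hkkt, ?_⟩
  have hcauchy : CauchySeq r.x := cauchySeq_of_summable_dist (hsum.congr fun k => by
    rw [Nat.succ_eq_add_one, dist_comm, dist_eq_norm])
  obtain ⟨a, ha⟩ := cauchySeq_tendsto_of_complete hcauchy
  exact ⟨a, ha.mapClusterPt, ha⟩
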